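/- **Theorem 1.1.** Let $\mathbb{D}$ be the open unit disc, $\mathbb{T}$ the unit circle with arc length $d\theta$. A weight is a function $\mu=|g|^2$, where $g$ is holomorphic on $\mathbb{D}$, continuous on $\overline{\mathbb{D}}$ and has no zeros in $\mathbb{D}$. Let $L^p(\mathbb{T},\mu)$ be the $L^p$ space of the measure $\mu\,d\theta$ on $\mathbb{T}$, and let $\mathcal{H}^2(\mathbb{T},\mu)\subset L^2(\mathbb{T},\mu)$ be the closed subspace of boundary functions (a.e. radial limits) of the holomorphic $f$ on $\mathbb{D}$ with $$\sup_{0\le r<1}\int_0^{2\pi}|f(re^{i\theta})|^2\,|g(re^{i\theta})|^2\,d\theta<\infty .$$ The weighted Szegő projection $\mathbf{S}_\mu$ is the orthogonal projection of $L^2(\mathbb{T},\mu)$ onto $\mathcal{H}^2(\mathbb{T},\mu)$. For $1<p<\infty$ it is called bounded on $L^p(\mathbb{T},\mu)$ if there is a constant $C$ with $\|\mathbf{S}_\mu f\|_{L^p(\mathbb{T},\mu)}\le C\,\|f\|_{L^p(\mathbb{T},\mu)}$ for all $f\in L^2(\mathbb{T},\mu)\cap L^p(\mathbb{T},\mu)$.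 Let $I_\mu$ be the set of $p\in(1,\infty)$ for which $\mathbf{S}_\mu$ is bounded on $L^p(\mathbb{T},\mu)$. For every $p_0>2$ there exists a weight $\mu$ such that $I_\mu=(q_0,p_0)$, where $\frac1{q_0}+\frac1{p_0}=1$; that is, for $1<p<\infty$, $\mathbf{S}_\mu$ is bounded on $L^p(\mathbb{T},\mu)$ if and only if $q_0<p<p_0$. -/

import Mathlib

open MeasureTheory Filter Topology Metric
open scoped ENNReal NNReal Real

noncomputable section

/-- The unit circle `𝕋`, parametrized by the angle `θ` modulo `2π`. Its measure `volume` is the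
arc length `dθ`, of total mass `2π`. The point `e^{iθ}` of `ℂ` is `(θ.toCircle : ℂ)`. -/
abbrev UnitCircle : Type := AddCircle (2 * π)

instance fact_two_pi_pos : Fact (0 < 2 * π) := ⟨Real.two_pi_pos⟩

/-- The weights of the theory, `μ = |g|²` on `𝕋`, given by their holomorphic root `g`:
holomorphic on the open unit disc, continuous on the closed disc, zero-free on the open disc. -/
structure HolomorphicWeight where
  /-- The holomorphic root; only its values on the closed unit disc matter. -/
  g : ℂ → ℂ
  differentiableOn : DifferentiableOn ℂ g (ball 0 1)
  continuousOn : ContinuousOn g (closedBall 0 1)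
  ne_zero : ∀ z ∈ ball (0 : ℂ) 1, g z ≠ 0

namespace HolomorphicWeight

variable (W : HolomorphicWeight)

/-- The measure `μ dθ = |g(e^{iθ})|² dθ` on `𝕋`. -/
def measure : Measure UnitCircle :=
  volume.withDensity fun θ : UnitCircle => ‖W.g (θ.toCircle : ℂ)‖ₑ ^ 2

/-- The squared weighted Hardy norm `sup_{0 ≤ r < 1} ∫ |f(re^{iθ}) g(re^{iθ})|² dθ` of a function
`f` on the disc. -/
def hardyNormSq (f : ℂ → ℂ) : ℝ≥0∞ :=
  ⨆ r ∈ Set.Ico (0 : ℝ) 1, ∫⁻ θ : UnitCircle,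
    ‖f ((r : ℂ) * (θ.toCircle : ℂ)) * W.g ((r : ℂ) * (θ.toCircle : ℂ))‖ₑ ^ 2

/-- `u` is the (radial) boundary function of an element `f` of the weighted Hardy space
`H²(𝕋, μ)`: `f` is holomorphic on the disc, its weighted Hardy norm is finite, and
`f(re^{iθ}) → u(θ)` as `r → 1⁻` for almost every `θ`. -/
def IsHardyBoundary (u : UnitCircle → ℂ) : Prop :=
  ∃ f : ℂ → ℂ, DifferentiableOn ℂ f (ball 0 1) ∧ W.hardyNormSq f < ∞ ∧
    ∀ᵐ θ ∂W.measure,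
      Tendsto (fun r : ℝ => f ((r : ℂ) * (θ.toCircle : ℂ))) (𝓝[<] 1) (𝓝 (u θ))

theorem mul_toCircle_mem_ball {r : ℝ} (hr : r ∈ Set.Ico (0 : ℝ) 1) (θ : UnitCircle) :
    (r : ℂ) * (θ.toCircle : ℂ) ∈ ball (0 : ℂ) 1 := by
  rw [mem_ball_zero_iff, norm_mul, Circle.norm_coe, mul_one, Complex.norm_real, Real.norm_eq_abs,
    abs_of_nonneg hr.1]
  exact hr.2

theorem continuous_dilate {f : ℂ → ℂ} (hf : DifferentiableOn ℂ f (ball 0 1)) {r : ℝ}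
    (hr : r ∈ Set.Ico (0 : ℝ) 1) :
    Continuous fun θ : UnitCircle => f ((r : ℂ) * (θ.toCircle : ℂ)) := by
  refine hf.continuousOn.comp_continuous ?_ fun θ => mul_toCircle_mem_ball hr θ
  exact continuous_const.mul (continuous_subtype_val.comp AddCircle.continuous_toCircle)

theorem hardyNormSq_add_lt_top {f h : ℂ → ℂ} (hfd : DifferentiableOn ℂ f (ball 0 1))
    (hf : W.hardyNormSq f < ∞) (hh : W.hardyNormSq h < ∞) :
    W.hardyNormSq (f + h) < ∞ := by
  refine lt_of_le_of_lt (b := 2 * (W.hardyNormSq f + W.hardyNormSq h)) ?_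
    (ENNReal.mul_lt_top (by simp) (ENNReal.add_lt_top.2 ⟨hf, hh⟩))
  refine iSup₂_le fun r hr => ?_
  have hle : ∀ k : ℂ → ℂ, (∫⁻ θ : UnitCircle,
      ‖k ((r : ℂ) * (θ.toCircle : ℂ)) * W.g ((r : ℂ) * (θ.toCircle : ℂ))‖ₑ ^ 2)
      ≤ W.hardyNormSq k := fun k => by
    unfold hardyNormSq
    exact le_iSup₂_of_le r hr le_rfl
  have hm : Measurable fun θ : UnitCircle =>
      ‖f ((r : ℂ) * (θ.toCircle : ℂ)) * W.g ((r : ℂ) * (θ.toCircle : ℂ))‖ₑ ^ 2 :=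
    (((continuous_dilate hfd hr).mul
      (continuous_dilate W.differentiableOn hr)).enorm.measurable).pow_const 2
  refine le_trans ?_ (mul_le_mul_right (add_le_add (hle f) (hle h)) 2)
  rw [← lintegral_add_left hm, ← lintegral_const_mul' _ _ (by simp)]
  refine lintegral_mono fun θ => ?_
  simp only [Pi.add_apply, add_mul]
  set a := f ((r : ℂ) * (θ.toCircle : ℂ)) * W.g ((r : ℂ) * (θ.toCircle : ℂ))
  set b := h ((r : ℂ) * (θ.toCircle : ℂ)) * W.g ((r : ℂ) * (θ.toCircle : ℂ))
  have key : ‖a + b‖₊ ^ 2 ≤ 2 * (‖a‖₊ ^ 2 + ‖b‖₊ ^ 2) := by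
    rw [← NNReal.coe_le_coe]
    push_cast
    nlinarith [norm_add_le a b, norm_nonneg (a + b), norm_nonneg a, norm_nonneg b,
      sq_nonneg (‖a‖ - ‖b‖)]
  simp only [enorm_eq_nnnorm]
  exact_mod_cast key

theorem hardyNormSq_smul_lt_top (c : ℂ) {f : ℂ → ℂ} (hf : W.hardyNormSq f < ∞) :
    W.hardyNormSq (c • f) < ∞ := by
  refine lt_of_le_of_lt (b := ‖c‖ₑ ^ 2 * W.hardyNormSq f) ?_
    (ENNReal.mul_lt_top (by simp) hf)
  refine iSup₂_le fun r hr => ?_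
  have : (∫⁻ θ : UnitCircle,
      ‖f ((r : ℂ) * (θ.toCircle : ℂ)) * W.g ((r : ℂ) * (θ.toCircle : ℂ))‖ₑ ^ 2)
      ≤ W.hardyNormSq f := by
    unfold hardyNormSq
    exact le_iSup₂_of_le r hr le_rfl
  refine le_trans (le_of_eq ?_) (mul_le_mul_right this (‖c‖ₑ ^ 2))
  rw [← lintegral_const_mul' _ _ (by simp)]
  refine lintegral_congr fun θ => ?_
  simp only [Pi.smul_apply, smul_eq_mul, enorm_mul]
  ring

/-- The weighted Hardy space `H²(𝕋, μ)`, as a subspace of `L²(𝕋, μ)` through boundary values. -/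
def hardySpace : Submodule ℂ (Lp ℂ 2 W.measure) where
  carrier := {u | W.IsHardyBoundary u}
  zero_mem' := by
    refine ⟨0, differentiableOn_const 0, by simp [hardyNormSq], ?_⟩
    filter_upwards [Lp.coeFn_zero ℂ 2 W.measure] with θ h
    rw [h]
    exact tendsto_const_nhds
  add_mem' := by
    rintro u v ⟨f, hf, hfn, hfl⟩ ⟨h, hh, hhn, hhl⟩
    refine ⟨f + h, hf.add hh, W.hardyNormSq_add_lt_top hf hfn hhn, ?_⟩
    filter_upwards [Lp.coeFn_add u v, hfl, hhl] with θ e h₁ h₂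
    rw [e]
    exact h₁.add h₂
  smul_mem' := by
    rintro c u ⟨f, hf, hfn, hfl⟩
    refine ⟨c • f, hf.const_smul c, W.hardyNormSq_smul_lt_top c hfn, ?_⟩
    filter_upwards [Lp.coeFn_smul c u, hfl] with θ e h₁
    rw [e]
    exact h₁.const_smul c

/-- The weighted Szegő projection `S_μ`: the orthogonal projection of `L²(𝕋, μ)` onto
`H²(𝕋, μ)`. The subspace `H²(𝕋, μ)` is closed, so taking its closure changes nothing; it only
lets Mathlib form the orthogonal projection without a proof of that fact. -/
def szegoProjection : Lp ℂ 2 W.measure →L[ℂ] Lp ℂ 2 W.measure :=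
  W.hardySpace.topologicalClosure.starProjection

/-- `S_μ` is bounded on `L^p(𝕋, μ)`: it satisfies `‖S_μ f‖_{p,μ} ≤ C ‖f‖_{p,μ}` for all `f` in
the dense subspace `L²(𝕋, μ) ∩ L^p(𝕋, μ)` of `L^p(𝕋, μ)`, and hence extends continuously (for
`p ≥ 2` this subspace is all of `L^p(𝕋, μ)`). -/
def BoundedOnLp (p : ℝ) : Prop :=
  ∃ C : ℝ≥0, ∀ f : Lp ℂ 2 W.measure, MemLp f (ENNReal.ofReal p) W.measure →
    eLpNorm (W.szegoProjection f) (ENNReal.ofReal p) W.measure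
      ≤ C * eLpNorm f (ENNReal.ofReal p) W.measure

/-- The boundedness interval `I_μ`: the exponents `p ∈ (1, ∞)` for which `S_μ` is bounded on
`L^p(𝕋, μ)`. -/
def boundednessInterval : Set ℝ :=
  {p | 1 < p ∧ W.BoundedOnLp p}

end HolomorphicWeight

end

open scoped ComplexConjugate InnerProductSpace

/-! The weight is `|1 - z| ^ (2a)` with root `g = (1 - z) ^ a` and `a = 1 / (p₀ - 2)`. Division by
`g` carries the unweighted theory to the weighted one: formally `S f = P(g f) / g`, with `P` the
ordinary Szegő projection. So `S` is bounded on `L^p(μ)` exactly when `P` is bounded on `L^p` of the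
density `|g| ^ (2 - p) = |1 - z| ^ (a (2 - p))`, and the `A_p` condition for a power, `-1 < a (2 -
p) < p - 1`, reads `q₀ < p < p₀`.

Only explicit cases of the formula are needed: `szegoProjection_eq_of_ae_eq` gives `S ((k + conj l)
/ g) = k / g` for `k`, `l` in the disc algebra with `l 0 = 0`.

For `q₀ < p < 2`, boundedness comes from M. Riesz's argument instead of `A_p` theory:
`exists_integral_norm_add_rpow_le` compares `|F|` with `Re F > 0` by applying the mean value
property to `F ^ p (1 - z) ^ α`, `α = a (2 - p)`, and `boundedOnLp_of_forall_re_pos` reduces general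
data to such `F`. The case `p = 2` is trivial, and `2 < p < p₀` follows by duality
(`BoundedOnLp.holderConjugate`).

For `p ≥ p₀` the single bounded function `conj z` has a projection outside `L^p(μ)`
(`not_boundedOnLp_powerWeight`); duality then excludes `p ≤ q₀`. -/

/-! ### Limits of integrals and mean values on the circle. -/

theorem tendsto_integral_of_tendsto_ae_of_eLpNorm_two_le {α : Type*} [MeasurableSpace α]
    {ν : Measure α} [IsFiniteMeasure ν] {G : ℕ → α → ℂ} {H : α → ℂ}
    (hG : ∀ n, AEStronglyMeasurable (G n) ν) (hH : Integrable H ν) {C : ℝ≥0∞} (hC : C ≠ ∞)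
    (hGC : ∀ n, eLpNorm (G n) 2 ν ≤ C)
    (h : ∀ᵐ x ∂ν, Tendsto (fun n => G n x) atTop (𝓝 (H x))) :
    Tendsto (fun n => ∫ x, G n x ∂ν) atTop (𝓝 (∫ x, H x ∂ν)) := by
  have hGi : ∀ n, Integrable (G n) ν := fun n =>
    MemLp.integrable (q := 2) (by norm_num) ⟨hG n, (hGC n).trans_lt hC.lt_top⟩
  refine tendsto_integral_of_L1' H hH.1 (Eventually.of_forall hGi) ?_
  refine tendsto_Lp_finite_of_tendsto_ae le_rfl (by simp) hG (memLp_one_iff_integrable.2 hH) ?_ h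
  intro ε hε
  -- Uniform integrability for Vitali's theorem: by Cauchy–Schwarz, the integral of `|G n|` over `s`
  -- is at most `C ν(s) ^ (1/2)`.
  have hlim : Tendsto (fun δ : ℝ => C * (ENNReal.ofReal δ) ^ (1 / 2 : ℝ)) (𝓝[>] 0) (𝓝 0) := by
    have h1 : Tendsto (fun δ : ℝ => C * (ENNReal.ofReal δ) ^ (1 / 2 : ℝ)) (𝓝[>] 0)
        (𝓝 (C * (ENNReal.ofReal 0) ^ (1 / 2 : ℝ))) := by
      refine ENNReal.Tendsto.const_mul ?_ (Or.inr hC)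
      refine (ENNReal.continuous_rpow_const.tendsto _).comp ?_
      exact (ENNReal.continuous_ofReal.tendsto 0).mono_left nhdsWithin_le_nhds
    simpa using h1
  have hev := (hlim.eventually_lt_const (ENNReal.ofReal_pos.2 hε)).and self_mem_nhdsWithin
  obtain ⟨δ, hδ, hδ0⟩ := hev.exists
  refine ⟨δ, hδ0, fun n s hs hνs => ?_⟩
  rw [eLpNorm_indicator_eq_eLpNorm_restrict hs]
  refine (eLpNorm_le_eLpNorm_mul_rpow_measure_univ (q := 2) (by norm_num) (hG n).restrict).trans ?_
  refine le_trans ?_ hδ.le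
  refine mul_le_mul' ((eLpNorm_mono_measure _ Measure.restrict_le_self).trans (hGC n)) ?_
  have : (1 / (1 : ℝ≥0∞).toReal - 1 / (2 : ℝ≥0∞).toReal) = (1 / 2 : ℝ) := by norm_num
  rw [this, Measure.restrict_apply_univ]
  exact ENNReal.rpow_le_rpow hνs (by norm_num)

theorem coe_toCircle_mem_closedBall (θ : UnitCircle) : (θ.toCircle : ℂ) ∈ closedBall (0 : ℂ) 1 := by
  rw [mem_closedBall_zero_iff, Circle.norm_coe]

theorem continuous_comp_toCircle {k : ℂ → ℂ} (hk : ContinuousOn k (closedBall 0 1)) :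
    Continuous fun θ : UnitCircle => k θ.toCircle :=
  hk.comp_continuous (continuous_subtype_val.comp AddCircle.continuous_toCircle)
    coe_toCircle_mem_closedBall

theorem coe_toCircle_coe (t : ℝ) :
    (AddCircle.toCircle (t : AddCircle (2 * π)) : ℂ) = Complex.exp (t * Complex.I) := by
  rw [AddCircle.toCircle_apply_mk, Circle.coe_exp, div_self Real.two_pi_pos.ne', one_mul]

theorem integral_toCircle_eq {k : ℂ → ℂ} {R : ℝ} (hk : DiffContOnCl ℂ k (ball 0 |R|)) :
    ∫ θ : UnitCircle, k (R * θ.toCircle) = 2 * π * k 0 := by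
  have h := hk.circleAverage
  rw [← AddCircle.intervalIntegral_preimage (2 * π) 0, ← h, Real.circleAverage]
  simp only [circleMap, coe_toCircle_coe, zero_add, Complex.real_smul]
  rw [← mul_assoc]
  push_cast
  rw [mul_inv_cancel₀, one_mul]
  exact_mod_cast Real.two_pi_pos.ne'

theorem integral_toCircle_eq_one {k : ℂ → ℂ} (hk : DifferentiableOn ℂ k (ball 0 1))
    (hkc : ContinuousOn k (closedBall 0 1)) :
    ∫ θ : UnitCircle, k θ.toCircle = 2 * π * k 0 := by
  have : DiffContOnCl ℂ k (ball 0 |1|) := by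
    rw [abs_one]
    exact DiffContOnCl.mk_ball hk hkc
  simpa using integral_toCircle_eq this

/-! ### The weighted Hardy space and explicit values of the projection. -/

namespace HolomorphicWeight

variable (W : HolomorphicWeight)

theorem continuous_boundary : Continuous fun θ : UnitCircle => W.g θ.toCircle :=
  continuous_comp_toCircle W.continuousOn

theorem measurable_density :
    Measurable fun θ : UnitCircle => ‖W.g (θ.toCircle : ℂ)‖ₑ ^ 2 :=
  W.continuous_boundary.enorm.measurable.pow_const 2

instance isFiniteMeasure_measure : IsFiniteMeasure W.measure := by
  refine isFiniteMeasure_withDensity ?_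
  obtain ⟨C, hC⟩ := isCompact_univ.exists_bound_of_continuousOn
    (W.continuous_boundary.continuousOn (s := Set.univ))
  refine ne_of_lt ((lintegral_mono (g := fun _ => ENNReal.ofReal C ^ 2) fun θ => ?_).trans_lt ?_)
  · have := hC θ (Set.mem_univ _)
    refine pow_le_pow_left' ?_ 2
    rw [← ofReal_norm]
    exact ENNReal.ofReal_le_ofReal this
  · rw [lintegral_const]
    exact ENNReal.mul_lt_top (by simp) (measure_lt_top _ _)

theorem measure_absolutelyContinuous : W.measure ≪ volume :=
  withDensity_absolutelyContinuous _ _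

theorem lintegral_measure {f : UnitCircle → ℝ≥0∞} (hf : AEMeasurable f volume) :
    ∫⁻ θ, f θ ∂W.measure = ∫⁻ θ, ‖W.g θ.toCircle‖ₑ ^ 2 * f θ :=
  lintegral_withDensity_eq_lintegral_mul₀ W.measurable_density.aemeasurable hf

theorem integral_measure (f : UnitCircle → ℂ) :
    ∫ θ, f θ ∂W.measure = ∫ θ, ((‖W.g θ.toCircle‖ ^ 2 : ℝ) : ℂ) * f θ := by
  rw [measure, integral_withDensity_eq_integral_toReal_smul W.measurable_density
    (Eventually.of_forall fun θ => by finiteness)]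
  simp

theorem ae_ne_zero : ∀ᵐ θ ∂W.measure, W.g θ.toCircle ≠ 0 := by
  rw [measure, ae_withDensity_iff W.measurable_density]
  refine Eventually.of_forall fun θ h h0 => h ?_
  simp [h0]

theorem eLpNorm_two_rpow {α : Type*} [MeasurableSpace α] (ν : Measure α) (f : α → ℂ) :
    eLpNorm f 2 ν = (∫⁻ x, ‖f x‖ₑ ^ 2 ∂ν) ^ (1 / 2 : ℝ) := by
  rw [eLpNorm_eq_lintegral_rpow_enorm_toReal (by norm_num) (by norm_num)]
  simp

theorem aestronglyMeasurable_div {k : UnitCircle → ℂ} (hk : AEStronglyMeasurable k volume) :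
    AEStronglyMeasurable (fun θ => k θ / W.g θ.toCircle) volume :=
  (hk.aemeasurable.div W.continuous_boundary.aemeasurable).aestronglyMeasurable

theorem eLpNorm_div_le {k : UnitCircle → ℂ} (hk : AEStronglyMeasurable k volume) :
    eLpNorm (fun θ => k θ / W.g θ.toCircle) 2 W.measure ≤ eLpNorm k 2 volume := by
  rw [eLpNorm_two_rpow, eLpNorm_two_rpow]
  refine ENNReal.rpow_le_rpow ?_ (by norm_num)
  rw [W.lintegral_measure ((W.aestronglyMeasurable_div hk).enorm.pow_const 2)]
  refine lintegral_mono fun θ => ?_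
  rw [← mul_pow, ← enorm_mul]
  gcongr
  rw [enorm_le_iff_norm_le, norm_mul, norm_div]
  rcases eq_or_ne (W.g θ.toCircle) 0 with h | h
  · simp [h]
  · rw [mul_div_cancel₀ _ (norm_ne_zero_iff.2 h)]

theorem memLp_div {k : UnitCircle → ℂ} (hk : MemLp k 2 volume) :
    MemLp (fun θ => k θ / W.g θ.toCircle) 2 W.measure :=
  ⟨(W.aestronglyMeasurable_div hk.1).mono_ac W.measure_absolutelyContinuous,
    (W.eLpNorm_div_le hk.1).trans_lt hk.2⟩

theorem memLp_mul (u : Lp ℂ 2 W.measure) :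
    MemLp (fun θ => u θ * W.g θ.toCircle) 2 volume := by
  have hu : Measurable u := (Lp.stronglyMeasurable u).measurable
  refine ⟨(hu.mul W.continuous_boundary.measurable).aestronglyMeasurable, ?_⟩
  have h := Lp.eLpNorm_lt_top u
  rw [eLpNorm_two_rpow, W.lintegral_measure (hu.enorm.pow_const 2).aemeasurable] at h
  rw [eLpNorm_two_rpow]
  convert h using 4 with θ
  rw [enorm_mul, mul_pow, mul_comm]

/-- The Hardy norm of `k / g` only sees `(k / g) g = k`, which is bounded; radial limits exist
wherever `g` does not vanish on the circle. -/
theorem mem_hardySpace_of_ae_eq_div {k : ℂ → ℂ} (hkd : DifferentiableOn ℂ k (ball 0 1))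
    (hkc : ContinuousOn k (closedBall 0 1)) {u : Lp ℂ 2 W.measure}
    (hu : u =ᵐ[W.measure] fun θ => k θ.toCircle / W.g θ.toCircle) : u ∈ W.hardySpace := by
  refine ⟨fun z => k z / W.g z, hkd.div W.differentiableOn W.ne_zero, ?_, ?_⟩
  · obtain ⟨C, hC⟩ := (isCompact_closedBall (0 : ℂ) 1).exists_bound_of_continuousOn hkc
    refine lt_of_le_of_lt (iSup₂_le fun r hr => ?_)
      (b := ∫⁻ _ : UnitCircle, ENNReal.ofReal C ^ 2) ?_
    · refine lintegral_mono fun θ => ?_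
      have hz := mul_toCircle_mem_ball hr θ
      rw [div_mul_cancel₀ _ (W.ne_zero _ hz)]
      gcongr
      rw [← ofReal_norm]
      exact ENNReal.ofReal_le_ofReal (hC _ (ball_subset_closedBall hz))
    · rw [lintegral_const]
      exact ENNReal.mul_lt_top (by simp) (measure_lt_top _ _)
  · filter_upwards [hu, W.ae_ne_zero] with θ h hne
    rw [h]
    have hr : Tendsto (fun r : ℝ => (r : ℂ) * (θ.toCircle : ℂ)) (𝓝[<] 1)
        (𝓝[closedBall 0 1] (θ.toCircle : ℂ)) := by
      refine tendsto_nhdsWithin_iff.2 ⟨?_, ?_⟩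
      · have : Continuous fun r : ℝ => (r : ℂ) * (θ.toCircle : ℂ) := by fun_prop
        simpa using (this.tendsto 1).mono_left nhdsWithin_le_nhds
      · filter_upwards [Ico_mem_nhdsLT (zero_lt_one' ℝ)] with r hr
        exact ball_subset_closedBall (mul_toCircle_mem_ball hr θ)
    exact ((hkc _ (coe_toCircle_mem_closedBall θ)).tendsto.comp hr).div
      ((W.continuousOn _ (coe_toCircle_mem_closedBall θ)).tendsto.comp hr) hne

/-- With `f` the extension of `u`, the function `k f g` is holomorphic and vanishes at `0`, so its
mean over each circle of radius `r < 1` is zero. The finite Hardy norm bounds these dilates in `L²`,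
which permits `r → 1`. -/
theorem integral_mul_boundary_eq_zero (hg : ∀ᵐ θ : UnitCircle, W.g θ.toCircle ≠ 0) {k : ℂ → ℂ}
    (hkd : DifferentiableOn ℂ k (ball 0 1)) (hkc : ContinuousOn k (closedBall 0 1)) (hk0 : k 0 = 0)
    {u : Lp ℂ 2 W.measure} (hu : u ∈ W.hardySpace) :
    ∫ θ : UnitCircle, k θ.toCircle * (u θ * W.g θ.toCircle) = 0 := by
  obtain ⟨f, hfd, hfn, hfl⟩ := hu
  obtain ⟨C, hC⟩ := (isCompact_closedBall (0 : ℂ) 1).exists_bound_of_continuousOn hkc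
  let r : ℕ → ℝ := fun n => 1 - 1 / ((n : ℝ) + 1)
  have hr : ∀ n, r n ∈ Set.Ico (0 : ℝ) 1 := fun n => by
    have h1 : (0 : ℝ) < (n : ℝ) + 1 := by positivity
    have h2 : 1 / ((n : ℝ) + 1) ≤ 1 := by
      rw [div_le_one h1]; linarith [n.cast_nonneg (α := ℝ)]
    have h3 : 0 < 1 / ((n : ℝ) + 1) := by positivity
    exact ⟨by simp only [r]; linarith, by simp only [r]; linarith⟩
  have hrt : Tendsto r atTop (𝓝 1) := by
    simpa [r] using tendsto_const_nhds.sub (tendsto_one_div_add_atTop_nhds_zero_nat (𝕜 := ℝ))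
  have hrt' : Tendsto r atTop (𝓝[<] 1) :=
    tendsto_nhdsWithin_iff.2 ⟨hrt, Eventually.of_forall fun n => (hr n).2⟩
  let K : ℂ → ℂ := fun z => k z * (f z * W.g z)
  have hKd : DifferentiableOn ℂ K (ball 0 1) := hkd.mul (hfd.mul W.differentiableOn)
  have hzero : ∀ n, ∫ θ : UnitCircle, K (r n * θ.toCircle) = 0 := fun n => by
    rw [integral_toCircle_eq]
    · simp [K, hk0]
    · refine DifferentiableOn.diffContOnCl (hKd.mono ?_)
      rw [abs_of_nonneg (hr n).1]
      exact closure_ball_subset_closedBall.trans (closedBall_subset_ball (hr n).2)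
  have hint : Integrable (fun θ : UnitCircle => k θ.toCircle * (u θ * W.g θ.toCircle)) volume := by
    refine ((W.memLp_mul u).integrable (by norm_num)).bdd_mul (c := C)
      (continuous_comp_toCircle hkc).aestronglyMeasurable ?_
    exact Eventually.of_forall fun θ => hC _ (coe_toCircle_mem_closedBall θ)
  have hlim := tendsto_integral_of_tendsto_ae_of_eLpNorm_two_le
    (G := fun n (θ : UnitCircle) => K (r n * θ.toCircle))
    (C := ENNReal.ofReal C * (W.hardyNormSq f) ^ (1 / 2 : ℝ))
    (fun n => (continuous_dilate hKd (hr n)).aestronglyMeasurable) hint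
    (ENNReal.mul_ne_top (by simp) (ENNReal.rpow_ne_top_of_nonneg (by norm_num) hfn.ne)) ?_ ?_
  · refine tendsto_nhds_unique hlim ?_
    simp only [hzero]
    exact tendsto_const_nhds
  · intro n
    have h1 : eLpNorm (fun θ : UnitCircle => K (r n * θ.toCircle)) 2 volume ≤ ENNReal.ofReal C *
        eLpNorm (fun θ : UnitCircle => f (r n * θ.toCircle) * W.g (r n * θ.toCircle)) 2 volume := by
      refine eLpNorm_le_mul_eLpNorm_of_ae_le_mul (Eventually.of_forall fun θ => ?_) _
      rw [norm_mul]
      gcongr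
      exact hC _ (ball_subset_closedBall (mul_toCircle_mem_ball (hr n) θ))
    refine h1.trans ?_
    rw [eLpNorm_two_rpow]
    gcongr
    unfold hardyNormSq
    exact le_iSup₂_of_le (r n) (hr n) le_rfl
  · have hfl' : ∀ᵐ θ : UnitCircle,
        Tendsto (fun r : ℝ => f ((r : ℂ) * (θ.toCircle : ℂ))) (𝓝[<] 1) (𝓝 (u θ)) := by
      filter_upwards [(ae_withDensity_iff W.measurable_density).1 hfl, hg] with θ h1 h2
      exact h1 (by simpa using h2)
    filter_upwards [hfl'] with θ h
    have hr' : Tendsto (fun n => (r n : ℂ) * (θ.toCircle : ℂ)) atTop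
        (𝓝[closedBall 0 1] (θ.toCircle : ℂ)) := by
      refine tendsto_nhdsWithin_iff.2 ⟨?_, Eventually.of_forall fun n =>
        ball_subset_closedBall (mul_toCircle_mem_ball (hr n) θ)⟩
      have : Continuous fun r : ℝ => (r : ℂ) * (θ.toCircle : ℂ) := by fun_prop
      simpa [Function.comp_def] using (this.tendsto 1).comp hrt
    exact ((hkc _ (coe_toCircle_mem_closedBall θ)).tendsto.comp hr').mul ((h.comp hrt').mul
      ((W.continuousOn _ (coe_toCircle_mem_closedBall θ)).tendsto.comp hr'))

/-- Conjugating `conj k / g` gives `k / conj g`, and the density `|g|²` turns this into `k g`: the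
pairing is the integral of `k u g`. -/
theorem inner_conj_div_hardySpace (hg : ∀ᵐ θ : UnitCircle, W.g θ.toCircle ≠ 0) {k : ℂ → ℂ}
    (hkd : DifferentiableOn ℂ k (ball 0 1)) (hkc : ContinuousOn k (closedBall 0 1)) (hk0 : k 0 = 0)
    {u v : Lp ℂ 2 W.measure} (hu : u ∈ W.hardySpace)
    (hv : v =ᵐ[W.measure] fun θ => conj (k θ.toCircle) / W.g θ.toCircle) : ⟪v, u⟫_ℂ = 0 := by
  rw [L2.inner_def, ← W.integral_mul_boundary_eq_zero hg hkd hkc hk0 hu]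
  have : ∫ θ, ⟪v θ, u θ⟫_ℂ ∂W.measure
      = ∫ θ, u θ * (k θ.toCircle / conj (W.g θ.toCircle)) ∂W.measure := by
    refine integral_congr_ae ?_
    filter_upwards [hv] with θ h
    rw [h, RCLike.inner_apply]
    simp
  rw [this, W.integral_measure]
  refine integral_congr_ae ?_
  filter_upwards [hg] with θ h
  have h' : conj (W.g θ.toCircle) ≠ 0 := by simpa using h
  rw [Complex.ofReal_pow, ← Complex.mul_conj']
  field_simp

/-- The part `k / g` lies in the Hardy space and the remainder `conj l / g` is orthogonal to it,
hence also to its closure. -/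
theorem szegoProjection_eq_of_ae_eq (hg : ∀ᵐ θ : UnitCircle, W.g θ.toCircle ≠ 0) {k l : ℂ → ℂ}
    (hkd : DifferentiableOn ℂ k (ball 0 1)) (hkc : ContinuousOn k (closedBall 0 1))
    (hld : DifferentiableOn ℂ l (ball 0 1)) (hlc : ContinuousOn l (closedBall 0 1)) (hl0 : l 0 = 0)
    {f v : Lp ℂ 2 W.measure}
    (hf : f =ᵐ[W.measure] fun θ => (k θ.toCircle + conj (l θ.toCircle)) / W.g θ.toCircle)
    (hv : v =ᵐ[W.measure] fun θ => k θ.toCircle / W.g θ.toCircle) :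
    W.szegoProjection f = v := by
  refine Submodule.eq_starProjection_of_mem_orthogonal
    (Submodule.le_topologicalClosure _ (W.mem_hardySpace_of_ae_eq_div hkd hkc hv)) ?_
  rw [Submodule.orthogonal_closure, Submodule.mem_orthogonal']
  intro u hu
  refine W.inner_conj_div_hardySpace hg hld hlc hl0 hu ?_
  filter_upwards [hf, hv, Lp.coeFn_sub f v] with θ h1 h2 h3
  rw [h3, Pi.sub_apply, h1, h2]
  ring

end HolomorphicWeight

/-! ### Duality between conjugate exponents. -/

theorem eLpNorm_ofReal_eq {α : Type*} [MeasurableSpace α] {ν : Measure α} (f : α → ℂ) {p : ℝ}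
    (hp : 0 < p) :
    eLpNorm f (ENNReal.ofReal p) ν = (∫⁻ x, ‖f x‖ₑ ^ p ∂ν) ^ (1 / p) := by
  rw [eLpNorm_eq_lintegral_rpow_enorm_toReal (by simpa using hp) (by simp),
    ENNReal.toReal_ofReal hp.le]

/-- The truncated integral `X` is finite, so `X ≤ K X ^ (1/p)` may be divided to give `X ^ (1/q) ≤
K`. Monotone convergence removes the truncation, without knowing beforehand that `v` is in `L^q`. -/
theorem eLpNorm_le_of_forall_truncation {α : Type*} [MeasurableSpace α] {ν : Measure α}
    [IsFiniteMeasure ν] {v : α → ℂ} {p q : ℝ} (hpq : p.HolderConjugate q)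
    {K : ℝ≥0∞} (H : ∀ N : ℕ, ∫⁻ x in {x | ‖v x‖ ≤ N}, ‖v x‖ₑ ^ q ∂ν
      ≤ K * (∫⁻ x in {x | ‖v x‖ ≤ N}, ‖v x‖ₑ ^ q ∂ν) ^ (1 / p)) :
    eLpNorm v (ENNReal.ofReal q) ν ≤ K := by
  have hq : 0 < q := hpq.symm.pos
  have hX : ∀ N : ℕ, ∫⁻ x in {x | ‖v x‖ ≤ N}, ‖v x‖ₑ ^ q ∂ν ≤ K ^ q := by
    intro N
    have hfin : ∫⁻ x in {x | ‖v x‖ ≤ N}, ‖v x‖ₑ ^ q ∂ν ≠ ∞ := by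
      refine ne_of_lt ((setLIntegral_mono (g := fun _ => ENNReal.ofReal N ^ q) measurable_const
        fun x hx => ?_).trans_lt ?_)
      · refine ENNReal.rpow_le_rpow ?_ hq.le
        rw [← ofReal_norm]
        exact ENNReal.ofReal_le_ofReal hx
      · rw [lintegral_const]
        exact ENNReal.mul_lt_top (ENNReal.rpow_lt_top_of_nonneg hq.le (by simp))
          (measure_lt_top _ _)
    have hN := H N
    set X := ∫⁻ x in {x | ‖v x‖ ≤ N}, ‖v x‖ₑ ^ q ∂ν
    rcases eq_or_ne X 0 with h0 | h0
    · rw [h0]; exact zero_le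
    rw [← ENNReal.rpow_inv_le_iff hq]
    have h1 : X ^ q⁻¹ * X ^ (1 / p) = X := by
      rw [← ENNReal.rpow_add _ _ h0 hfin, one_div, add_comm, hpq.inv_add_inv_eq_one,
        ENNReal.rpow_one]
    have h2 : X ^ (1 / p) ≠ 0 := by simp [ENNReal.rpow_eq_zero_iff, h0, hfin]
    have h3 : X ^ (1 / p) ≠ ∞ :=
      ENNReal.rpow_ne_top_of_nonneg (one_div_nonneg.2 hpq.pos.le) hfin
    rw [← ENNReal.mul_le_mul_iff_left h2 h3, h1]
    exact hN
  rw [eLpNorm_ofReal_eq v hq, one_div, ENNReal.rpow_inv_le_iff hq]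
  have hU : (⋃ N : ℕ, {x | ‖v x‖ ≤ N}) = Set.univ := by
    refine Set.eq_univ_of_forall fun x => Set.mem_iUnion.2 ?_
    exact exists_nat_ge ‖v x‖
  have hmono : Monotone fun N : ℕ => {x | ‖v x‖ ≤ N} := fun M N h x hx =>
    le_trans (show ‖v x‖ ≤ M from hx) (Nat.cast_le.2 h)
  rw [← setLIntegral_univ, ← hU, setLIntegral_iUnion_of_directed _ hmono.directed_le]
  exact iSup_le hX

namespace HolomorphicWeight

variable (W : HolomorphicWeight)

theorem inner_szegoProjection_left (u v : Lp ℂ 2 W.measure) :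
    ⟪W.szegoProjection u, v⟫_ℂ = ⟪u, W.szegoProjection v⟫_ℂ :=
  Submodule.inner_starProjection_left_eq_right _ u v

theorem enorm_inner_le_eLpNorm_mul_eLpNorm {p q : ℝ} (hpq : p.HolderConjugate q)
    (u v : Lp ℂ 2 W.measure) :
    ‖⟪u, v⟫_ℂ‖ₑ ≤ eLpNorm u (ENNReal.ofReal p) W.measure
      * eLpNorm v (ENNReal.ofReal q) W.measure := by
  rw [L2.inner_def, eLpNorm_ofReal_eq _ hpq.pos, eLpNorm_ofReal_eq _ hpq.symm.pos]
  refine (enorm_integral_le_lintegral_enorm _).trans (le_trans (le_of_eq ?_)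
    (ENNReal.lintegral_mul_le_Lp_mul_Lq W.measure hpq
      (Lp.stronglyMeasurable u).measurable.enorm.aemeasurable
      (Lp.stronglyMeasurable v).measurable.enorm.aemeasurable))
  refine lintegral_congr fun x => ?_
  simp only [RCLike.inner_apply, enorm_mul, Pi.mul_apply, RCLike.enorm_conj, mul_comm]

/-- The projection is self-adjoint, so testing `S f` against `u` moves `S` onto `u`, where the `L^p`
bound applies. -/
theorem BoundedOnLp.holderConjugate {W : HolomorphicWeight} {p q : ℝ} (hpq : p.HolderConjugate q)
    (h : W.BoundedOnLp p) : W.BoundedOnLp q := by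
  obtain ⟨C, hC⟩ := h
  refine ⟨C, fun f _ => ?_⟩
  set v := W.szegoProjection f with hvdef
  have hv : Measurable v := (Lp.stronglyMeasurable v).measurable
  refine eLpNorm_le_of_forall_truncation hpq fun N => ?_
  have hs : MeasurableSet {x | ‖v x‖ ≤ N} := measurableSet_le hv.norm measurable_const
  -- The extremal function in Hölder's inequality, truncated to be bounded: its pairing with `v` is
  -- the truncated integral of `|v| ^ q`, and so is the integral of `|h₀| ^ p`, because `(q - 1) p =
  -- q`.
  let h₀ : UnitCircle → ℂ := {x | ‖v x‖ ≤ N}.indicator fun x => v x * ((‖v x‖ ^ (q - 2) : ℝ) : ℂ)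
  have hnorm : ∀ z : ℂ, ‖z * ((‖z‖ ^ (q - 2) : ℝ) : ℂ)‖ = ‖z‖ ^ (q - 1) := fun z => by
    rcases eq_or_ne z 0 with rfl | hz
    · simp [Real.zero_rpow hpq.symm.sub_one_ne_zero]
    · have hz' : 0 < ‖z‖ := norm_pos_iff.2 hz
      rw [norm_mul, Complex.norm_real, Real.norm_of_nonneg (by positivity)]
      nth_rw 1 [← Real.rpow_one ‖z‖]
      rw [← Real.rpow_add hz']
      ring_nf
  have hmeas : Measurable h₀ :=
    (hv.mul (Complex.measurable_ofReal.comp (hv.norm.pow_const _))).indicator hs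
  have hmem : ∀ r : ℝ≥0∞, MemLp h₀ r W.measure := fun r => by
    refine MemLp.of_bound hmeas.aestronglyMeasurable ((N : ℝ) ^ (q - 1))
      (Eventually.of_forall fun x => ?_)
    simp only [h₀, Set.indicator_apply]
    split_ifs with hx
    · rw [hnorm]
      exact Real.rpow_le_rpow (norm_nonneg _) hx hpq.symm.sub_one_pos.le
    · simp only [norm_zero]; positivity
  set u := (hmem 2).toLp h₀
  have hu : u =ᵐ[W.measure] h₀ := MemLp.coeFn_toLp _
  have hup : eLpNorm u (ENNReal.ofReal p) W.measure
      = (∫⁻ x in {x | ‖v x‖ ≤ N}, ‖v x‖ₑ ^ q ∂W.measure) ^ (1 / p) := by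
    rw [eLpNorm_congr_ae hu, eLpNorm_ofReal_eq _ hpq.pos, ← lintegral_indicator hs]
    congr 1
    refine lintegral_congr fun x => ?_
    simp only [h₀, Set.indicator_apply]
    split_ifs with hx
    · rw [← ofReal_norm, hnorm, ← ENNReal.ofReal_rpow_of_nonneg (norm_nonneg _)
        hpq.symm.sub_one_pos.le, ← ENNReal.rpow_mul, ofReal_norm, 
        show (q - 1) * p = q by linarith [hpq.mul_eq_add]]
    · simp [hpq.pos]
  have hinner : ‖⟪u, v⟫_ℂ‖ₑ = ∫⁻ x in {x | ‖v x‖ ≤ N}, ‖v x‖ₑ ^ q ∂W.measure := by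
    have h1 : ⟪u, v⟫_ℂ
        = ∫ x, (({x | ‖v x‖ ≤ N}.indicator (fun x => ‖v x‖ ^ q) x : ℝ) : ℂ) ∂W.measure := by
      rw [L2.inner_def]
      refine integral_congr_ae ?_
      filter_upwards [hu] with x hx
      rw [hx, RCLike.inner_apply]
      simp only [h₀, Set.indicator_apply]
      split_ifs with hxN
      · rw [map_mul, Complex.conj_ofReal, ← mul_assoc, Complex.mul_conj', ← Complex.ofReal_pow,
          ← Complex.ofReal_mul]
        rcases eq_or_ne (v x) 0 with hz | hz
        · simp [hz, Real.zero_rpow hpq.symm.pos.ne']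
        · rw [← Real.rpow_natCast, ← Real.rpow_add (norm_pos_iff.2 hz)]
          norm_num
      · simp
    have hnn : ∀ x, 0 ≤ {x | ‖v x‖ ≤ N}.indicator (fun x => ‖v x‖ ^ q) x := fun x =>
      Set.indicator_nonneg (fun _ _ => by positivity) _
    have hint : Integrable ({x | ‖v x‖ ≤ N}.indicator (fun x => ‖v x‖ ^ q)) W.measure := by
      refine Integrable.of_bound ((hv.norm.pow_const q).indicator hs).aestronglyMeasurable
        ((N : ℝ) ^ q) (Eventually.of_forall fun x => ?_)
      rw [Real.norm_of_nonneg (hnn x), Set.indicator_apply]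
      split_ifs with hx
      · exact Real.rpow_le_rpow (norm_nonneg _) hx hpq.symm.pos.le
      · positivity
    rw [h1, integral_complex_ofReal, ← ofReal_norm, Complex.norm_real, Real.norm_eq_abs,
      abs_of_nonneg (integral_nonneg hnn),
      ofReal_integral_eq_lintegral_ofReal hint (Eventually.of_forall hnn), ← lintegral_indicator hs]
    refine lintegral_congr fun x => ?_
    simp only [Set.indicator_apply]
    split_ifs with hx
    · rw [← ENNReal.ofReal_rpow_of_nonneg (norm_nonneg _) hpq.symm.pos.le, ofReal_norm]
    · simp
  conv_lhs => rw [← hinner, hvdef, ← W.inner_szegoProjection_left]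
  refine (W.enorm_inner_le_eLpNorm_mul_eLpNorm hpq _ _).trans ?_
  calc _ ≤ (C * eLpNorm u (ENNReal.ofReal p) W.measure) * eLpNorm f (ENNReal.ofReal q) W.measure :=
        mul_le_mul_left (hC u ((memLp_congr_ae hu).2 (hmem _))) _
    _ = _ := by
      rw [hup]
      ring

theorem boundedOnLp_two : W.BoundedOnLp 2 := by
  refine ⟨1, fun f _ => ?_⟩
  have h : ‖W.szegoProjection f‖ ≤ ‖f‖ :=
    (ContinuousLinearMap.le_opNorm _ _).trans
      (mul_le_of_le_one_left (norm_nonneg _) (Submodule.starProjection_norm_le _))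
  rw [show ENNReal.ofReal 2 = 2 by simp, ENNReal.coe_one, one_mul, ← Lp.enorm_def, ← Lp.enorm_def,
    enorm_le_iff_norm_le]
  exact h

end HolomorphicWeight

/-! ### The weighted Riesz inequality. -/

/-- When `|t|` is near `π/2`, the angle `|p t + α s|` lies strictly between `π/2` and `3π/2`: the
two hypotheses on `p ± α` say exactly this at the extremes. There the cosine is negative and the `B`
term suffices; elsewhere `cos t` is bounded below and a large `A` suffices. -/
theorem exists_one_le_mul_cos_rpow_sub_mul_cos {p α : ℝ} (hα : 0 < α) (h₁ : α < p - 1)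
    (h₂ : p + α < 3) :
    ∃ A B : ℝ, 0 ≤ A ∧ 0 < B ∧ ∀ t s : ℝ, |t| ≤ π / 2 → |s| ≤ π / 2 →
      1 ≤ A * Real.cos t ^ p - B * Real.cos (p * t + α * s) := by
  have hp : 1 < p := by linarith
  have hπ := Real.pi_pos
  -- The first bound is `p (π/2 - δ) - α π/2 ≥ π/2 + δ`, the second `(p + α) π/2 ≤ 3π/2 - δ`.
  obtain ⟨δ, hδ0, hδ₁, hδ₂⟩ : ∃ δ : ℝ, 0 < δ ∧ (p + 1) * δ ≤ (p - α - 1) * (π / 2) ∧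
      δ ≤ (3 - p - α) * (π / 2) := by
    refine ⟨min ((p - α - 1) * (π / 2) / (p + 1)) ((3 - p - α) * (π / 2)), ?_, ?_, min_le_right _ _⟩
    · refine lt_min (div_pos (mul_pos ?_ ?_) ?_) (mul_pos ?_ ?_) <;> linarith
    · rw [← le_div_iff₀' (by linarith)]
      exact min_le_left _ _
  have hδπ : δ < π / 2 := by
    have : (p + 1) * δ < (p + 1) * (π / 2) :=
      hδ₁.trans_lt (mul_lt_mul_of_pos_right (by linarith) (by linarith))
    exact lt_of_mul_lt_mul_left this (by linarith)
  have hc : 0 < Real.sin δ := Real.sin_pos_of_pos_of_lt_pi hδ0 (by linarith)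
  have hcp : 0 < Real.sin δ ^ p := Real.rpow_pos_of_pos hc p
  refine ⟨(1 + 1 / Real.sin δ) / Real.sin δ ^ p, 1 / Real.sin δ, by positivity, by positivity,
    fun t s ht hs => ?_⟩
  have hcos : 0 ≤ Real.cos t := by
    rw [← Real.cos_abs]
    exact Real.cos_nonneg_of_neg_pi_div_two_le_of_le (by linarith [abs_nonneg t]) ht
  rcases le_total (π / 2 - δ) |t| with h | h
  · have h1 : Real.cos (p * t + α * s) ≤ -Real.sin δ := by
      have hlow : π / 2 + δ ≤ |p * t + α * s| := by
        have e1 : |p * t| ≤ |p * t + α * s| + |α * s| := by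
          simpa using abs_sub (p * t + α * s) (α * s)
        rw [abs_mul, abs_mul, abs_of_pos hα, abs_of_pos (by linarith : 0 < p)] at e1
        nlinarith
      have hup : |p * t + α * s| ≤ 3 * π / 2 - δ := by
        have e1 := abs_add_le (p * t) (α * s)
        rw [abs_mul, abs_mul, abs_of_pos hα, abs_of_pos (by linarith : 0 < p)] at e1
        nlinarith
      rw [← Real.cos_abs]
      set x := |p * t + α * s|
      have e2 : Real.sin δ ≤ Real.cos (x - π) := by
        rw [← Real.cos_pi_div_two_sub, ← Real.cos_abs (x - π)]
        refine Real.cos_le_cos_of_nonneg_of_le_pi (abs_nonneg _) (by linarith) ?_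
        rw [abs_le]; constructor <;> linarith
      rw [Real.cos_sub_pi] at e2
      linarith
    have h2 : 1 / Real.sin δ * Real.cos (p * t + α * s) ≤ -1 := by
      rw [one_div, inv_mul_le_iff₀ hc]; linarith
    have h3 : 0 ≤ (1 + 1 / Real.sin δ) / Real.sin δ ^ p * Real.cos t ^ p := by positivity
    linarith
  · have h1 : Real.sin δ ≤ Real.cos t := by
      rw [← Real.cos_pi_div_two_sub, ← Real.cos_abs t]
      exact Real.cos_le_cos_of_nonneg_of_le_pi (abs_nonneg _) (by linarith) h
    have h2 : 1 + 1 / Real.sin δ ≤ (1 + 1 / Real.sin δ) / Real.sin δ ^ p * Real.cos t ^ p := by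
      rw [div_mul_eq_mul_div, le_div_iff₀ hcp]
      exact mul_le_mul_of_nonneg_left (Real.rpow_le_rpow hc.le h1 (by linarith)) (by positivity)
    have h3 : 1 / Real.sin δ * Real.cos (p * t + α * s) ≤ 1 / Real.sin δ :=
      mul_le_of_le_one_right (by positivity) (Real.cos_le_one _)
    linarith

/-- The preceding inequality with `t = arg w`, `s = arg ζ`, multiplied by `‖w‖ ^ p ‖ζ‖ ^ α`. -/
theorem exists_norm_rpow_mul_le_re_cpow {p α : ℝ} (hα : 0 < α) (h₁ : α < p - 1)
    (h₂ : p + α < 3) :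
    ∃ A B : ℝ, 0 ≤ A ∧ 0 < B ∧ ∀ w ζ : ℂ, 0 < w.re → 0 ≤ ζ.re →
      ‖w‖ ^ p * ‖ζ‖ ^ α
        ≤ A * (w.re ^ p * ‖ζ‖ ^ α) - B * (w ^ (p : ℂ) * ζ ^ (α : ℂ)).re := by
  obtain ⟨A, B, hA, hB, h⟩ := exists_one_le_mul_cos_rpow_sub_mul_cos hα h₁ h₂
  refine ⟨A, B, hA, hB, fun w ζ hw hζ => ?_⟩
  have hk := h w.arg ζ.arg (Complex.abs_arg_le_pi_div_two_iff.2 hw.le)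
    (Complex.abs_arg_le_pi_div_two_iff.2 hζ)
  have hcos : 0 ≤ Real.cos w.arg := Real.cos_nonneg_of_mem_Icc
    (abs_le.1 (Complex.abs_arg_le_pi_div_two_iff.2 hw.le))
  have hre : w.re ^ p = ‖w‖ ^ p * Real.cos w.arg ^ p := by
    rw [← Real.mul_rpow (norm_nonneg _) hcos, Complex.norm_mul_cos_arg]
  have hprod : (w ^ (p : ℂ) * ζ ^ (α : ℂ)).re
      = ‖w‖ ^ p * ‖ζ‖ ^ α * Real.cos (p * w.arg + α * ζ.arg) := by
    rw [Complex.mul_re, Complex.cpow_ofReal_re, Complex.cpow_ofReal_re, Complex.cpow_ofReal_im,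
      Complex.cpow_ofReal_im, Real.cos_add]
    rw [mul_comm p, mul_comm α]
    ring
  rw [hre, hprod]
  have := mul_le_mul_of_nonneg_left hk (by positivity : 0 ≤ ‖w‖ ^ p * ‖ζ‖ ^ α)
  linarith

theorem one_sub_mem_slitPlane {z : ℂ} (hz : z ∈ closedBall (0 : ℂ) 1) (h1 : z ≠ 1) :
    1 - z ∈ Complex.slitPlane := by
  rw [mem_closedBall_zero_iff] at hz
  refine Or.inl ?_
  rw [Complex.sub_re, Complex.one_re, sub_pos]
  refine lt_of_le_of_ne ((Complex.re_le_norm z).trans hz) fun h => h1 ?_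
  have h2 : z.re ^ 2 + z.im ^ 2 ≤ 1 := by
    have := Complex.sq_norm z
    rw [Complex.normSq_apply] at this
    nlinarith [norm_nonneg z]
  have h3 : z.im = 0 := by
    rw [h] at h2
    nlinarith [sq_nonneg z.im]
  exact Complex.ext h h3

theorem ne_one_of_mem_ball {z : ℂ} (hz : z ∈ ball (0 : ℂ) 1) : z ≠ 1 := by
  rintro rfl
  simp at hz

theorem differentiableOn_one_sub_cpow (α : ℝ) :
    DifferentiableOn ℂ (fun z : ℂ => (1 - z) ^ (α : ℂ)) (ball 0 1) := fun _ hz =>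
  ((differentiableAt_id.const_sub 1).cpow_const (one_sub_mem_slitPlane (ball_subset_closedBall hz)
    (ne_one_of_mem_ball hz))).differentiableWithinAt

theorem continuousOn_one_sub_cpow {α : ℝ} (hα : 0 < α) :
    ContinuousOn (fun z : ℂ => (1 - z) ^ (α : ℂ)) (closedBall 0 1) := by
  intro z hz
  rcases eq_or_ne z 1 with rfl | h1
  · have h := Complex.continuousAt_cpow_zero_of_re_pos (z := (α : ℂ)) (by simpa using hα)
    have h2 : ContinuousAt (fun z : ℂ => ((1 - z, (α : ℂ)) : ℂ × ℂ)) 1 := by fun_prop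
    exact (ContinuousAt.comp (g := fun x : ℂ × ℂ => x.1 ^ x.2) (by simpa using h)
      h2).continuousWithinAt
  · have h : ContinuousAt (fun z : ℂ => 1 - z) z := by fun_prop
    exact (h.cpow continuousAt_const (one_sub_mem_slitPlane hz h1)).continuousWithinAt

/-- The maximum modulus principle for `exp (-F)`, whose modulus is `exp (-Re F)`. -/
theorem re_pos_of_forall_sphere_le_re {F : ℂ → ℂ} (hF : Differentiable ℂ F) {δ : ℝ} (hδ : 0 < δ)
    (h : ∀ z ∈ sphere (0 : ℂ) 1, δ ≤ (F z).re) {z : ℂ} (hz : z ∈ closedBall (0 : ℂ) 1) :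
    0 < (F z).re := by
  have hd : DiffContOnCl ℂ (fun z => Complex.exp (-F z)) (ball 0 1) :=
    hF.neg.cexp.diffContOnCl
  have := Complex.norm_le_of_forall_mem_frontier_norm_le isBounded_ball hd (C := Real.exp (-δ))
    (fun w hw => by
      rw [frontier_ball _ one_ne_zero] at hw
      rw [Complex.norm_exp, Real.exp_le_exp, Complex.neg_re]
      linarith [h w hw])
    (z := z) (by rwa [closure_ball _ one_ne_zero])
  rw [Complex.norm_exp, Real.exp_le_exp, Complex.neg_re] at this
  linarith

/-- A weighted form of M. Riesz's inequality for conjugate functions, by the method of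
integrating `F ^ p * (1 - z) ^ α` over the circle. -/
theorem exists_integral_norm_add_rpow_le {p α : ℝ} (hα : 0 < α) (h₁ : α < p - 1) (h₂ : p + α < 3) :
    ∃ C : ℝ, 0 ≤ C ∧ ∀ F : ℂ → ℂ, Differentiable ℂ F → (F 0).im = 0 →
      (∃ δ > 0, ∀ z ∈ sphere (0 : ℂ) 1, δ ≤ (F z).re) →
      ∫ θ : UnitCircle, ‖F θ.toCircle + F 0‖ ^ p * ‖1 - (θ.toCircle : ℂ)‖ ^ α
        ≤ C * ∫ θ : UnitCircle, (F θ.toCircle).re ^ p * ‖1 - (θ.toCircle : ℂ)‖ ^ α := by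
  have hp : 0 < p := by linarith
  obtain ⟨A, B, hA, hB, hAB⟩ := exists_norm_rpow_mul_le_re_cpow hα h₁ h₂
  set M := ∫ θ : UnitCircle, ‖1 - (θ.toCircle : ℂ)‖ ^ α
  have hM : 0 ≤ M := integral_nonneg fun θ => by positivity
  have hB' : 0 < B * (2 * π) := by positivity
  refine ⟨2 ^ p * (A + M * A / (B * (2 * π))), by positivity, fun F hF hF0 ⟨δ, hδ, hFδ⟩ => ?_⟩
  have hre : ∀ z ∈ closedBall (0 : ℂ) 1, 0 < (F z).re := fun z hz =>
    re_pos_of_forall_sphere_le_re hF hδ hFδ hz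
  have hF0re : 0 < (F 0).re := hre 0 (by simp)
  have hF0' : F 0 = ((F 0).re : ℂ) := Complex.ext rfl (by simpa using hF0)
  have hcT : Continuous fun θ : UnitCircle => (θ.toCircle : ℂ) :=
    continuous_comp_toCircle continuousOn_id
  have hcF : Continuous fun θ : UnitCircle => F θ.toCircle := hF.continuous.comp hcT
  have hcw : Continuous fun θ : UnitCircle => ‖1 - (θ.toCircle : ℂ)‖ ^ α :=
    (continuous_const.sub hcT).norm.rpow_const fun _ => Or.inr hα.le
  have hI : ∀ {f : UnitCircle → ℝ}, Continuous f → Integrable f volume := fun hf =>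
    hf.integrable_of_hasCompactSupport (HasCompactSupport.of_compactSpace _)
  have hi₁ : Integrable fun θ : UnitCircle => ‖F θ.toCircle‖ ^ p * ‖1 - (θ.toCircle : ℂ)‖ ^ α :=
    hI ((hcF.norm.rpow_const fun _ => Or.inr hp.le).mul hcw)
  have hi₂ : Integrable fun θ : UnitCircle => (F θ.toCircle).re ^ p * ‖1 - (θ.toCircle : ℂ)‖ ^ α :=
    hI (((Complex.continuous_re.comp hcF).rpow_const fun _ => Or.inr hp.le).mul hcw)
  -- Positivity of `Re F` keeps `F` off the branch cut, so `K` is in the disc algebra and its mean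
  -- is `K 0 = (F 0) ^ p`, a positive number.
  let K : ℂ → ℂ := fun z => F z ^ (p : ℂ) * (1 - z) ^ (α : ℂ)
  have hKd : DifferentiableOn ℂ K (ball 0 1) :=
    (hF.differentiableOn.cpow_const fun z hz => Or.inl (hre z (ball_subset_closedBall hz))).mul
      (differentiableOn_one_sub_cpow α)
  have hKc : ContinuousOn K (closedBall 0 1) :=
    (hF.continuous.continuousOn.cpow continuousOn_const fun z hz => Or.inl (hre z hz)).mul
      (continuousOn_one_sub_cpow hα)
  have hK0 : K 0 = (((F 0).re ^ p : ℝ) : ℂ) := by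
    simp only [K]
    rw [Complex.ofReal_cpow hF0re.le, ← hF0', sub_zero, Complex.one_cpow, mul_one]
  have hi₃ : Integrable fun θ : UnitCircle => K θ.toCircle :=
    (continuous_comp_toCircle hKc).integrable_of_hasCompactSupport
      (HasCompactSupport.of_compactSpace _)
  have hi₃' : Integrable fun θ : UnitCircle => (K θ.toCircle).re := hi₃.re
  have hKint : ∫ θ : UnitCircle, (K θ.toCircle).re = 2 * π * (F 0).re ^ p := by
    have h := integral_re (𝕜 := ℂ) hi₃
    simp only [RCLike.re_to_complex] at h
    rw [h, integral_toCircle_eq_one hKd hKc, hK0, ← Complex.ofReal_ofNat, ← Complex.ofReal_mul,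
      ← Complex.ofReal_mul, Complex.ofReal_re]
  set I := ∫ θ : UnitCircle, (F θ.toCircle).re ^ p * ‖1 - (θ.toCircle : ℂ)‖ ^ α
  have hmain : ∫ θ : UnitCircle, ‖F θ.toCircle‖ ^ p * ‖1 - (θ.toCircle : ℂ)‖ ^ α
      ≤ A * I - B * (2 * π * (F 0).re ^ p) := by
    rw [← hKint, ← integral_const_mul, ← integral_const_mul, ← integral_sub (hi₂.const_mul A)
      (hi₃'.const_mul B)]
    refine integral_mono hi₁ ((hi₂.const_mul A).sub (hi₃'.const_mul B)) fun θ => ?_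
    refine hAB _ _ (hre _ (coe_toCircle_mem_closedBall θ)) ?_
    rw [Complex.sub_re, Complex.one_re, sub_nonneg]
    exact (Complex.re_le_norm _).trans (Circle.norm_coe _).le
  have hnn : 0 ≤ ∫ θ : UnitCircle, ‖F θ.toCircle‖ ^ p * ‖1 - (θ.toCircle : ℂ)‖ ^ α :=
    integral_nonneg fun θ => by positivity
  have hF0p : 0 < (F 0).re ^ p := Real.rpow_pos_of_pos hF0re p
  -- The estimate `hmain` is used twice: dropping its negative term bounds the integral of `|F| ^
  -- p`, while dropping its left side bounds `F 0`.
  have hJ : ∫ θ : UnitCircle, ‖F θ.toCircle‖ ^ p * ‖1 - (θ.toCircle : ℂ)‖ ^ α ≤ A * I := by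
    have : 0 < B * (2 * π * (F 0).re ^ p) := by positivity
    linarith
  have hF0I : (F 0).re ^ p ≤ A * I / (B * (2 * π)) := by
    rw [le_div_iff₀ hB']
    linarith
  have hi₄ : Integrable fun θ : UnitCircle => (F 0).re ^ p * ‖1 - (θ.toCircle : ℂ)‖ ^ α :=
    (hI hcw).const_mul _
  have hle : ∫ θ : UnitCircle, ‖F θ.toCircle + F 0‖ ^ p * ‖1 - (θ.toCircle : ℂ)‖ ^ α
      ≤ ∫ θ : UnitCircle, 2 ^ p * (‖F θ.toCircle‖ ^ p * ‖1 - (θ.toCircle : ℂ)‖ ^ α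
        + (F 0).re ^ p * ‖1 - (θ.toCircle : ℂ)‖ ^ α) := by
    refine integral_mono (hI (((hcF.add continuous_const).norm.rpow_const
      fun _ => Or.inr hp.le).mul hcw)) ((hi₁.add hi₄).const_mul _) fun θ => ?_
    simp only
    rw [← add_mul, ← mul_assoc]
    refine mul_le_mul_of_nonneg_right ?_ (by positivity)
    have hn0 : ‖F 0‖ = (F 0).re := by
      rw [hF0', Complex.norm_real, Real.norm_of_nonneg hF0re.le, Complex.ofReal_re]
    set x := ‖F θ.toCircle‖
    set y := (F 0).re
    have hx : 0 ≤ x := norm_nonneg _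
    have h3 : ‖F θ.toCircle + F 0‖ ≤ 2 * max x y := by
      refine (norm_add_le _ _).trans ?_
      rw [hn0]
      linarith [le_max_left x y, le_max_right x y]
    refine (Real.rpow_le_rpow (norm_nonneg _) h3 hp.le).trans ?_
    rw [Real.mul_rpow (by norm_num) (hx.trans (le_max_left _ _))]
    refine mul_le_mul_of_nonneg_left ?_ (by positivity)
    have hxp : 0 ≤ x ^ p := by positivity
    rcases max_choice x y with h | h <;> rw [h] <;> linarith
  refine hle.trans ?_
  rw [integral_const_mul, integral_add hi₁ hi₄, integral_const_mul]
  have h5 : (F 0).re ^ p * M ≤ A * I / (B * (2 * π)) * M := mul_le_mul_of_nonneg_right hF0I hM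
  have h6 : A * I + A * I / (B * (2 * π)) * M = (A + M * A / (B * (2 * π))) * I := by ring
  rw [mul_assoc]
  refine mul_le_mul_of_nonneg_left ?_ (by positivity)
  linarith

/-! ### Reduction to positive real parts of entire functions. -/

theorem exists_differentiable_re_eq_of_mem_span_fourier {P : C(UnitCircle, ℂ)}
    (hP : P ∈ Submodule.span ℂ (Set.range (@fourier (2 * π)))) :
    ∃ F : ℂ → ℂ, Differentiable ℂ F ∧ ∀ θ, (P θ).re = (F θ.toCircle).re := by
  -- Taking real parts is not complex linear, so the induction carries an arbitrary factor `c`. For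
  -- negative frequencies, conjugating leaves the real part unchanged and produces a monomial in
  -- `z`.
  suffices H : ∀ c : ℂ, ∃ F : ℂ → ℂ, Differentiable ℂ F ∧
      ∀ θ, (c * P θ).re = (F θ.toCircle).re by simpa using H 1
  induction hP using Submodule.span_induction with
  | mem P h =>
    obtain ⟨n, rfl⟩ := h
    intro c
    rcases Int.eq_nat_or_neg n with ⟨m, rfl | rfl⟩
    · refine ⟨fun z => c * z ^ m, by fun_prop, fun θ => ?_⟩
      simp [fourier_apply, AddCircle.toCircle_nsmul]
    · refine ⟨fun z => conj c * z ^ m, by fun_prop, fun θ => ?_⟩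
      have h : ((fourier (-(m : ℤ)) θ : ℂ)) = conj ((θ.toCircle : ℂ) ^ m) := by
        rw [map_pow, ← Circle.coe_inv_eq_conj]
        simp [fourier_apply, AddCircle.toCircle_nsmul, AddCircle.toCircle_neg]
      rw [h, ← Complex.conj_re (conj c * _), map_mul, Complex.conj_conj]
  | zero => exact fun c => ⟨0, differentiable_const 0, by simp⟩
  | add P Q _ _ hP hQ =>
    intro c
    obtain ⟨F, hF, hF'⟩ := hP c
    obtain ⟨G, hG, hG'⟩ := hQ c
    refine ⟨F + G, hF.add hG, fun θ => ?_⟩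
    rw [ContinuousMap.add_apply, mul_add, Complex.add_re, hF', hG', Pi.add_apply, Complex.add_re]
  | smul a P _ hP =>
    intro c
    obtain ⟨F, hF, hF'⟩ := hP (c * a)
    refine ⟨F, hF, fun θ => ?_⟩
    rw [← hF', ContinuousMap.smul_apply, smul_eq_mul, mul_assoc]

theorem exists_toCircle_eq {z : ℂ} (hz : z ∈ sphere (0 : ℂ) 1) :
    ∃ θ : UnitCircle, (θ.toCircle : ℂ) = z := by
  refine ⟨((z.arg : ℝ) : AddCircle (2 * π)), ?_⟩
  rw [coe_toCircle_coe]
  have := Complex.norm_mul_exp_arg_mul_I z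
  rwa [mem_sphere_zero_iff_norm.1 hz, Complex.ofReal_one, one_mul] at this

/-- Nonnegative square-integrable functions on the circle are limits of strictly positive
boundary values of real parts of entire functions. -/
theorem exists_differentiable_re_approx {φ : UnitCircle → ℝ} (hφ : MemLp φ 2 volume)
    (h0 : ∀ θ, 0 ≤ φ θ) {ε : ℝ≥0∞} (hε : ε ≠ 0) :
    ∃ F : ℂ → ℂ, Differentiable ℂ F ∧ (F 0).im = 0 ∧
      (∃ δ > 0, ∀ z ∈ sphere (0 : ℂ) 1, δ ≤ (F z).re) ∧
      eLpNorm (fun θ => (F θ.toCircle).re - φ θ) 2 volume ≤ ε := by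
  have hε2 : ε / 2 ≠ 0 := (ENNReal.half_pos hε).ne'
  obtain ⟨v, hv, -⟩ := hφ.exists_boundedContinuous_eLpNorm_sub_le (by norm_num) hε2
  obtain ⟨η, hη, hηε⟩ : ∃ η : ℝ, 0 < η ∧
      volume (Set.univ : Set UnitCircle) ^ ((2 : ℝ≥0∞).toReal⁻¹) * ENNReal.ofReal (2 * η)
        ≤ ε / 2 := by
    have hc : volume (Set.univ : Set UnitCircle) ^ ((2 : ℝ≥0∞).toReal⁻¹) ≠ ∞ :=
      ENNReal.rpow_ne_top_of_nonneg (by positivity) (measure_ne_top _ _)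
    have hlim : Tendsto (fun η : ℝ => volume (Set.univ : Set UnitCircle) ^ ((2 : ℝ≥0∞).toReal⁻¹) *
        ENNReal.ofReal (2 * η)) (𝓝[>] 0) (𝓝 0) := by
      have h1 : Continuous fun η : ℝ => volume (Set.univ : Set UnitCircle) ^
          ((2 : ℝ≥0∞).toReal⁻¹) * ENNReal.ofReal (2 * η) :=
        (ENNReal.continuous_const_mul hc).comp
          (ENNReal.continuous_ofReal.comp (continuous_const.mul continuous_id))
      simpa using (h1.tendsto 0).mono_left nhdsWithin_le_nhds
    obtain ⟨η, h1, h2⟩ := ((hlim.eventually_lt_const (pos_iff_ne_zero.2 hε2)).and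
      self_mem_nhdsWithin).exists
    exact ⟨η, h2, h1.le⟩
  -- The absolute value does not worsen the approximation of `φ ≥ 0`, and the shift by `η` keeps a
  -- trigonometric polynomial within `η / 2` at least `η / 2` in real part.
  let V : C(UnitCircle, ℂ) := ⟨fun θ => ((|v θ| + η : ℝ) : ℂ), by fun_prop⟩
  have hV : V ∈ (Submodule.span ℂ (Set.range (@fourier (2 * π)))).topologicalClosure := by
    rw [span_fourier_closure_eq_top]
    exact Submodule.mem_top
  obtain ⟨P, hP, hVP⟩ := Metric.mem_closure_iff.1 hV (η / 2) (by linarith)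
  obtain ⟨F, hF, hPF⟩ := exists_differentiable_re_eq_of_mem_span_fourier hP
  have hbd : ∀ θ : UnitCircle, |(F θ.toCircle).re - (|v θ| + η)| ≤ η / 2 := fun θ => by
    have h1 : ‖V θ - P θ‖ ≤ η / 2 := by
      rw [← dist_eq_norm]
      exact (ContinuousMap.dist_apply_le_dist θ).trans hVP.le
    have h2 := (Complex.abs_re_le_norm _).trans h1
    rw [Complex.sub_re, hPF, abs_sub_comm] at h2
    simpa [V] using h2
  refine ⟨fun z => F z - (F 0).im * Complex.I, by fun_prop, by simp, ⟨η / 2, by linarith,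
    fun z hz => ?_⟩, ?_⟩
  · obtain ⟨θ, rfl⟩ := exists_toCircle_eq hz
    have := (abs_le.1 (hbd θ)).1
    simp only [Complex.sub_re, Complex.mul_re, Complex.ofReal_re, Complex.I_re, Complex.ofReal_im,
      mul_zero, zero_mul, sub_zero]
    linarith [abs_nonneg (v θ)]
  · have hFc : Continuous fun θ : UnitCircle => (F θ.toCircle).re :=
      Complex.continuous_re.comp (continuous_comp_toCircle hF.continuous.continuousOn)
    have e : (fun θ : UnitCircle => (F θ.toCircle - (F 0).im * Complex.I).re - φ θ)
        = (fun θ : UnitCircle => (F θ.toCircle).re - |v θ|) + fun θ => |v θ| - φ θ := by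
      ext θ
      simp
    rw [e]
    refine (eLpNorm_add_le (by fun_prop) ?_ (by norm_num)).trans ?_
    · exact (v.continuous.abs.aestronglyMeasurable).sub hφ.1
    rw [← ENNReal.add_halves ε]
    refine add_le_add ?_ ?_
    · refine (eLpNorm_le_of_ae_bound (C := 2 * η) (Eventually.of_forall fun θ => ?_)).trans hηε
      have := abs_le.1 (hbd θ)
      rw [Real.norm_eq_abs, abs_le]
      constructor <;> linarith
    · refine (eLpNorm_mono fun θ => ?_).trans hv
      rw [Pi.sub_apply, Real.norm_eq_abs, Real.norm_eq_abs, abs_sub_comm]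
      have := abs_abs_sub_abs_le (φ θ) (v θ)
      rwa [abs_of_nonneg (h0 θ)] at this

namespace HolomorphicWeight

variable (W : HolomorphicWeight)

theorem enorm_szegoProjection_le (f : Lp ℂ 2 W.measure) : ‖W.szegoProjection f‖ₑ ≤ ‖f‖ₑ := by
  rw [enorm_le_iff_norm_le]
  exact (ContinuousLinearMap.le_opNorm _ _).trans
      (mul_le_of_le_one_left (norm_nonneg _) (Submodule.starProjection_norm_le _))

theorem eLpNorm_add_coe_le {p : ℝ≥0∞} (hp : 1 ≤ p) (u v : Lp ℂ 2 W.measure) :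
    eLpNorm (u + v : Lp ℂ 2 W.measure) p W.measure
      ≤ eLpNorm u p W.measure + eLpNorm v p W.measure := by
  rw [eLpNorm_congr_ae (Lp.coeFn_add u v)]
  exact eLpNorm_add_le (Lp.aestronglyMeasurable u) (Lp.aestronglyMeasurable v) hp

theorem eLpNorm_coe_le {p : ℝ≥0∞} (hp : p ≤ 2) (u : Lp ℂ 2 W.measure) :
    eLpNorm u p W.measure
      ≤ ‖u‖ₑ * W.measure Set.univ ^ (1 / p.toReal - 1 / (2 : ℝ≥0∞).toReal) := by
  rw [Lp.enorm_def]
  exact eLpNorm_le_eLpNorm_mul_rpow_measure_univ hp (Lp.aestronglyMeasurable u)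

/-- Approximation in `L²` is enough: `S` is an `L²` contraction, and for `p ≤ 2` the `L²` norm
controls the `L^p` norm because the measure is finite. -/
theorem eLpNorm_szegoProjection_le_of_nonneg {p : ℝ≥0∞} (hp1 : 1 ≤ p) (hp2 : p ≤ 2) {C : ℝ≥0}
    (h : ∀ F : ℂ → ℂ, Differentiable ℂ F → (F 0).im = 0 →
      (∃ δ > 0, ∀ z ∈ sphere (0 : ℂ) 1, δ ≤ (F z).re) → ∀ f : Lp ℂ 2 W.measure,
      f =ᵐ[W.measure] (fun θ => ((F θ.toCircle).re : ℂ) / W.g θ.toCircle) →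
      eLpNorm (W.szegoProjection f) p W.measure ≤ C * eLpNorm f p W.measure)
    {φ : UnitCircle → ℝ} (hφ : MemLp φ 2 volume) (h0 : ∀ θ, 0 ≤ φ θ) {f : Lp ℂ 2 W.measure}
    (hf : f =ᵐ[W.measure] fun θ => (φ θ : ℂ) / W.g θ.toCircle) :
    eLpNorm (W.szegoProjection f) p W.measure ≤ C * eLpNorm f p W.measure := by
  set c := W.measure Set.univ ^ (1 / p.toReal - 1 / (2 : ℝ≥0∞).toReal)
  have hc : c ≠ ∞ := by
    refine ENNReal.rpow_ne_top_of_nonneg ?_ (measure_ne_top _ _)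
    have hp0 : 0 < p.toReal := ENNReal.toReal_pos (by positivity) (hp2.trans_lt (by simp)).ne
    exact sub_nonneg.2 (one_div_le_one_div_of_le hp0 (ENNReal.toReal_mono (by simp) hp2))
  have key : ∀ ε : ℝ≥0∞, ε ≠ 0 → eLpNorm (W.szegoProjection f) p W.measure
      ≤ C * (eLpNorm f p W.measure + c * ε) + c * ε := by
    intro ε hε
    obtain ⟨F, hF, hF0, hFδ, hFφ⟩ := exists_differentiable_re_approx hφ h0 hε
    have hFm : MemLp (fun θ : UnitCircle => ((F θ.toCircle).re : ℂ)) 2 volume :=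
      (Complex.continuous_ofReal.comp (Complex.continuous_re.comp
        (continuous_comp_toCircle hF.continuous.continuousOn))).memLp_of_hasCompactSupport
        (HasCompactSupport.of_compactSpace _)
    set u := (W.memLp_div hFm).toLp
    have hu : u =ᵐ[W.measure] fun θ => ((F θ.toCircle).re : ℂ) / W.g θ.toCircle :=
      MemLp.coeFn_toLp _
    have hd : ‖u - f‖ₑ ≤ ε := by
      rw [Lp.enorm_def, eLpNorm_congr_ae (g := fun θ =>
        (((F θ.toCircle).re - φ θ : ℝ) : ℂ) / W.g θ.toCircle)]
      · refine (W.eLpNorm_div_le ?_).trans ?_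
        · exact Complex.continuous_ofReal.comp_aestronglyMeasurable
            ((Complex.continuous_re.comp (continuous_comp_toCircle
              hF.continuous.continuousOn)).aestronglyMeasurable.sub hφ.1)
        · refine le_trans (eLpNorm_mono fun θ => ?_) hFφ
          rw [Complex.norm_real]
      · filter_upwards [Lp.coeFn_sub u f, hu, hf] with θ h1 h2 h3
        rw [h1, Pi.sub_apply, h2, h3, Complex.ofReal_sub, sub_div]
    have hd' : ‖f - u‖ₑ ≤ ε := by rwa [enorm_sub_rev]
    have h1 : eLpNorm (W.szegoProjection f) p W.measure
        ≤ eLpNorm (W.szegoProjection u) p W.measure + c * ε := by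
      have e : W.szegoProjection f = W.szegoProjection u + W.szegoProjection (f - u) := by
        rw [← map_add, add_sub_cancel]
      rw [e]
      refine (W.eLpNorm_add_coe_le hp1 _ _).trans (add_le_add le_rfl ?_)
      refine (W.eLpNorm_coe_le hp2 _).trans ?_
      rw [mul_comm]
      exact mul_le_mul_right ((W.enorm_szegoProjection_le _).trans hd') _
    have h2 : eLpNorm u p W.measure ≤ eLpNorm f p W.measure + c * ε := by
      have e : u = f + (u - f) := by abel
      rw [e]
      refine (W.eLpNorm_add_coe_le hp1 _ _).trans (add_le_add le_rfl ?_)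
      refine (W.eLpNorm_coe_le hp2 _).trans ?_
      rw [mul_comm]
      exact mul_le_mul_right hd _
    refine h1.trans (add_le_add ((h F hF hF0 hFδ u hu).trans ?_) le_rfl)
    exact mul_le_mul_right h2 _
  have hcont : Continuous fun ε : ℝ≥0∞ => C * (eLpNorm f p W.measure + c * ε) + c * ε :=
    ((ENNReal.continuous_const_mul ENNReal.coe_ne_top).comp
      (continuous_const.add (ENNReal.continuous_const_mul hc))).add
      (ENNReal.continuous_const_mul hc)
  have hlim : Tendsto (fun ε : ℝ≥0∞ => C * (eLpNorm f p W.measure + c * ε) + c * ε) (𝓝[>] 0)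
      (𝓝 (C * eLpNorm f p W.measure)) := by
    simpa using (hcont.tendsto 0).mono_left nhdsWithin_le_nhds
  have : (𝓝[>] (0 : ℝ≥0∞)).NeBot := nhdsGT_neBot_of_exists_gt ⟨1, one_pos⟩
  refine ge_of_tendsto hlim ?_
  filter_upwards [self_mem_nhdsWithin] with ε hε
  exact key ε (ne_of_gt hε)

/-- For `p ≤ 2`, it suffices to bound the Szegő projection on functions of the form `Re F / g`
with `F` entire and `Re F` positive on the circle. -/
theorem boundedOnLp_of_forall_re_pos {p : ℝ} (hp1 : 1 ≤ p) (hp2 : p ≤ 2) {C : ℝ≥0}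
    (h : ∀ F : ℂ → ℂ, Differentiable ℂ F → (F 0).im = 0 →
      (∃ δ > 0, ∀ z ∈ sphere (0 : ℂ) 1, δ ≤ (F z).re) → ∀ f : Lp ℂ 2 W.measure,
      f =ᵐ[W.measure] (fun θ => ((F θ.toCircle).re : ℂ) / W.g θ.toCircle) →
      eLpNorm (W.szegoProjection f) (ENNReal.ofReal p) W.measure
        ≤ C * eLpNorm f (ENNReal.ofReal p) W.measure) : W.BoundedOnLp p := by
  have hp1' : 1 ≤ ENNReal.ofReal p := by simpa using hp1
  have hp2' : ENNReal.ofReal p ≤ 2 := ENNReal.ofReal_le_ofNat.2 hp2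
  refine ⟨4 * C, fun f _ => ?_⟩
  -- The positive and negative parts of the real and imaginary parts of `f g`, so that `f g` is the
  -- sum of `I ^ k φ k` over `k < 4`. The four terms account for the constant `4 * C`.
  let φ : ℕ → UnitCircle → ℝ := fun k θ =>
    max ((-Complex.I) ^ k * (f θ * W.g θ.toCircle)).re 0
  have hle : ∀ k θ, |φ k θ| ≤ ‖f θ * W.g θ.toCircle‖ := fun k θ => by
    rw [abs_of_nonneg (le_max_right _ _)]
    refine max_le ((Complex.re_le_norm _).trans ?_) (norm_nonneg _)
    simp
  have hφm : ∀ k, MemLp (φ k) 2 volume := fun k => by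
    have hm : AEStronglyMeasurable (φ k) volume := by
      have := (W.memLp_mul f).1.aemeasurable
      exact ((Complex.measurable_re.comp_aemeasurable (this.const_mul _)).max
        aemeasurable_const).aestronglyMeasurable
    exact (W.memLp_mul f).mono hm (Eventually.of_forall fun θ => hle k θ)
  let u : ℕ → Lp ℂ 2 W.measure := fun k => (W.memLp_div (hφm k).ofReal).toLp
  have hu : ∀ k, u k =ᵐ[W.measure] fun θ => ((φ k θ : ℝ) : ℂ) / W.g θ.toCircle := fun k =>
    MemLp.coeFn_toLp _
  have hbd : ∀ k, eLpNorm (W.szegoProjection (Complex.I ^ k • u k)) (ENNReal.ofReal p) W.measure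
      ≤ C * eLpNorm f (ENNReal.ofReal p) W.measure := fun k => by
    rw [map_smul, eLpNorm_congr_ae (Lp.coeFn_smul _ _), eLpNorm_const_smul, enorm_pow]
    have hI : ‖Complex.I‖ₑ = 1 := by rw [← ofReal_norm, Complex.norm_I, ENNReal.ofReal_one]
    rw [hI, one_pow, one_mul]
    refine (W.eLpNorm_szegoProjection_le_of_nonneg hp1' hp2' h (hφm k)
      (fun θ => le_max_right _ _) (hu k)).trans (mul_le_mul_right ?_ _)
    refine eLpNorm_mono_ae ?_
    filter_upwards [hu k, W.ae_ne_zero] with θ h1 h2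
    rw [h1, norm_div, Complex.norm_real, div_le_iff₀ (norm_pos_iff.2 h2), ← norm_mul]
    exact hle k θ
  have hsum : f = Complex.I ^ 0 • u 0 + Complex.I ^ 1 • u 1
      + (Complex.I ^ 2 • u 2 + Complex.I ^ 3 • u 3) := by
    refine Lp.ext ?_
    filter_upwards [Lp.coeFn_add (Complex.I ^ 0 • u 0 + Complex.I ^ 1 • u 1)
        (Complex.I ^ 2 • u 2 + Complex.I ^ 3 • u 3),
      Lp.coeFn_add (Complex.I ^ 0 • u 0) (Complex.I ^ 1 • u 1),
      Lp.coeFn_add (Complex.I ^ 2 • u 2) (Complex.I ^ 3 • u 3),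
      Lp.coeFn_smul (Complex.I ^ 0) (u 0), Lp.coeFn_smul (Complex.I ^ 1) (u 1),
      Lp.coeFn_smul (Complex.I ^ 2) (u 2), Lp.coeFn_smul (Complex.I ^ 3) (u 3),
      hu 0, hu 1, hu 2, hu 3, W.ae_ne_zero] with θ a b c d0 d1 d2 d3 e0 e1 e2 e3 hne
    rw [a, Pi.add_apply, b, c, Pi.add_apply, Pi.add_apply, d0, d1, d2, d3, Pi.smul_apply,
      Pi.smul_apply, Pi.smul_apply, Pi.smul_apply, e0, e1, e2, e3]
    have hI3 : Complex.I ^ 3 = -Complex.I := by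
      rw [pow_succ, Complex.I_sq]; ring
    have hI3' : (-Complex.I) ^ 3 = Complex.I := by
      rw [Odd.neg_pow (by decide), hI3, neg_neg]
    simp only [φ, smul_eq_mul, ← mul_div_assoc, ← add_div]
    rw [eq_div_iff hne]
    set x := f θ * W.g θ.toCircle
    rw [hI3, hI3', neg_sq, Complex.I_sq]
    simp only [pow_zero, pow_one, one_mul, neg_mul, Complex.neg_re, Complex.mul_re, Complex.I_re,
      Complex.I_im, zero_mul, zero_sub, neg_neg]
    apply Complex.ext
    · simp [← sub_eq_add_neg]
    · simp [← sub_eq_add_neg]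
  conv_lhs => rw [hsum, map_add, map_add, map_add]
  refine (W.eLpNorm_add_coe_le hp1' _ _).trans ((add_le_add (W.eLpNorm_add_coe_le hp1' _ _)
    (W.eLpNorm_add_coe_le hp1' _ _)).trans ((add_le_add (add_le_add (hbd 0) (hbd 1))
    (add_le_add (hbd 2) (hbd 3))).trans (le_of_eq ?_)))
  push_cast
  ring

end HolomorphicWeight

/-! ### Power weights: boundedness below `2` and failure for large exponents. -/

/-- The weight `|1 - z| ^ (2 * a)`, with holomorphic root `(1 - z) ^ a`. -/
noncomputable def powerWeight (a : ℝ) (ha : 0 < a) : HolomorphicWeight where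
  g z := (1 - z) ^ (a : ℂ)
  differentiableOn := differentiableOn_one_sub_cpow a
  continuousOn := continuousOn_one_sub_cpow ha
  ne_zero z hz := by
    rw [Complex.cpow_ne_zero_iff]
    exact Or.inl (sub_ne_zero.2 (ne_one_of_mem_ball hz).symm)

theorem ae_toCircle_ne_one : ∀ᵐ θ : UnitCircle, (θ.toCircle : ℂ) ≠ 1 := by
  have h : {θ : UnitCircle | ¬ (θ.toCircle : ℂ) ≠ 1} ⊆ {0} := fun θ hθ => by
    refine AddCircle.injective_toCircle Real.two_pi_pos.ne' ?_
    rw [AddCircle.toCircle_zero]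
    exact Circle.ext (by simpa using hθ)
  have hs : volume ({0} : Set UnitCircle) = 0 := by
    have := AddCircle.volume_closedBall (T := 2 * π) (x := 0) 0
    simpa [Real.pi_pos.le] using this
  exact measure_mono_null h hs

namespace HolomorphicWeight

theorem norm_powerWeight_g {a : ℝ} (ha : 0 < a) (z : ℂ) :
    ‖(powerWeight a ha).g z‖ = ‖1 - z‖ ^ a :=
  Complex.norm_cpow_real _ _

theorem ae_powerWeight_g_ne_zero {a : ℝ} (ha : 0 < a) :
    ∀ᵐ θ : UnitCircle, (powerWeight a ha).g θ.toCircle ≠ 0 := by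
  filter_upwards [ae_toCircle_ne_one] with θ h
  rw [← norm_pos_iff, norm_powerWeight_g]
  exact Real.rpow_pos_of_pos (norm_pos_iff.2 (sub_ne_zero.2 h.symm)) _

/-- Dividing by `g` costs `|g| ^ (-p)` and the measure contributes `|g|²`, whence the exponent `a (2
- p)`. -/
theorem eLpNorm_div_powerWeight {a p : ℝ} (ha : 0 < a) (hp : 0 < p) {k : UnitCircle → ℂ}
    (hk : AEStronglyMeasurable k volume) :
    eLpNorm (fun θ => k θ / (powerWeight a ha).g θ.toCircle) (ENNReal.ofReal p)
        (powerWeight a ha).measure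
      = (∫⁻ θ : UnitCircle,
          ENNReal.ofReal (‖k θ‖ ^ p * ‖1 - (θ.toCircle : ℂ)‖ ^ (a * (2 - p)))) ^ (1 / p) := by
  rw [eLpNorm_ofReal_eq _ hp, lintegral_measure _
    (((powerWeight a ha).aestronglyMeasurable_div hk).enorm.pow_const p)]
  congr 1
  refine lintegral_congr_ae ?_
  filter_upwards [ae_toCircle_ne_one] with θ h
  have hx : 0 < ‖1 - (θ.toCircle : ℂ)‖ := norm_pos_iff.2 (sub_ne_zero.2 h.symm)
  rw [← ofReal_norm, ← ofReal_norm, ENNReal.ofReal_rpow_of_nonneg (norm_nonneg _) hp.le,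
    ← ENNReal.ofReal_pow (norm_nonneg _), ← ENNReal.ofReal_mul (by positivity), norm_div,
    norm_powerWeight_g]
  congr 1
  rw [Real.div_rpow (norm_nonneg _) (by positivity), ← Real.rpow_natCast, ← Real.rpow_mul hx.le,
    ← Real.rpow_mul hx.le, mul_sub, Real.rpow_sub hx]
  push_cast
  ring

theorem boundedOnLp_powerWeight_of_le_two {a p : ℝ} (ha : 0 < a) (hp1 : 1 < p) (hp2 : p < 2)
    (hap : a * (2 - p) < p - 1) : (powerWeight a ha).BoundedOnLp p := by
  have hp : 0 < p := by linarith
  obtain ⟨C, hC0, hC⟩ := exists_integral_norm_add_rpow_le (p := p)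
    (mul_pos ha (by linarith : 0 < 2 - p)) hap (by linarith)
  have hα : 0 ≤ a * (2 - p) := mul_nonneg ha.le (by linarith)
  refine (powerWeight a ha).boundedOnLp_of_forall_re_pos (C := (C ^ (1 / p)).toNNReal) hp1.le hp2.le
    fun F hF hF0 hFδ f hf => ?_
  have hcT : Continuous fun θ : UnitCircle => (θ.toCircle : ℂ) :=
    continuous_comp_toCircle continuousOn_id
  have hcF : Continuous fun θ : UnitCircle => F θ.toCircle := hF.continuous.comp hcT
  have hF0' : conj (F 0) = F 0 := Complex.conj_eq_iff_im.2 hF0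
  have hcw : Continuous fun θ : UnitCircle => ‖1 - (θ.toCircle : ℂ)‖ ^ (a * (2 - p)) :=
    (continuous_const.sub hcT).norm.rpow_const fun _ => Or.inr hα
  have hkm : MemLp (fun θ : UnitCircle => (F θ.toCircle + F 0) / 2) 2 volume :=
    ((hcF.add continuous_const).div_const 2).memLp_of_hasCompactSupport
      (HasCompactSupport.of_compactSpace _)
  set v := ((powerWeight a ha).memLp_div hkm).toLp
  have hv : v =ᵐ[(powerWeight a ha).measure]
      fun θ => ((F θ.toCircle + F 0) / 2) / (powerWeight a ha).g θ.toCircle := MemLp.coeFn_toLp _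
  -- As `F 0` is real, `Re F = (F + F 0) / 2 + conj ((F - F 0) / 2)`, and the second summand
  -- vanishes at the origin.
  have hS : (powerWeight a ha).szegoProjection f = v := by
    refine szegoProjection_eq_of_ae_eq _ (ae_powerWeight_g_ne_zero ha)
      (k := fun z => (F z + F 0) / 2) (l := fun z => (F z - F 0) / 2)
      (by fun_prop) ((hF.continuous.add continuous_const).div_const 2).continuousOn
      (by fun_prop) ((hF.continuous.sub continuous_const).div_const 2).continuousOn (by simp) ?_ hv
    filter_upwards [hf] with θ h
    rw [h, Complex.re_eq_add_conj, map_div₀, map_sub, hF0', map_ofNat]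
    ring
  have hi : ∀ {k : UnitCircle → ℝ}, Continuous k → (∀ θ, 0 ≤ k θ) →
      ∫⁻ θ, ENNReal.ofReal (k θ) = ENNReal.ofReal (∫ θ, k θ) := fun hk h0 =>
    (ofReal_integral_eq_lintegral_ofReal (hk.integrable_of_hasCompactSupport
      (HasCompactSupport.of_compactSpace _)) (Eventually.of_forall h0)).symm
  have hcre : Continuous fun θ : UnitCircle => (F θ.toCircle).re := Complex.continuous_re.comp hcF
  have hcre' : Continuous fun θ : UnitCircle => (((F θ.toCircle).re : ℝ) : ℂ) :=
    Complex.continuous_ofReal.comp hcre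
  have hre : ∀ θ : UnitCircle, 0 ≤ (F θ.toCircle).re := fun θ => by
    obtain ⟨δ, hδ, h⟩ := hFδ
    exact hδ.le.trans (h _ (mem_sphere_zero_iff_norm.2 (Circle.norm_coe _)))
  rw [hS, eLpNorm_congr_ae hv, eLpNorm_congr_ae hf, eLpNorm_div_powerWeight ha hp hkm.1,
    eLpNorm_div_powerWeight ha hp hcre'.aestronglyMeasurable]
  change _ ≤ ENNReal.ofReal (C ^ (1 / p)) * _
  rw [← ENNReal.ofReal_rpow_of_nonneg hC0 (by positivity),
    ← ENNReal.mul_rpow_of_nonneg _ _ (by positivity)]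
  refine ENNReal.rpow_le_rpow ?_ (by positivity)
  have e : ∀ θ : UnitCircle, ‖(((F θ.toCircle).re : ℝ) : ℂ)‖ = (F θ.toCircle).re := fun θ => by
    rw [Complex.norm_real, Real.norm_of_nonneg (hre θ)]
  simp only [e]
  rw [hi (k := fun θ : UnitCircle => (F θ.toCircle).re ^ p *
      ‖1 - (θ.toCircle : ℂ)‖ ^ (a * (2 - p))) ((hcre.rpow_const fun _ => Or.inr hp.le).mul hcw)
    (fun θ => mul_nonneg (Real.rpow_nonneg (hre θ) _) (by positivity)), ← ENNReal.ofReal_mul hC0]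
  refine le_trans ?_ (ENNReal.ofReal_le_ofReal (hC F hF hF0 hFδ))
  rw [← hi (k := fun θ : UnitCircle => ‖F θ.toCircle + F 0‖ ^ p *
      ‖1 - (θ.toCircle : ℂ)‖ ^ (a * (2 - p))) (((hcF.add continuous_const).norm.rpow_const fun _ => Or.inr hp.le).mul hcw)
    fun θ => by positivity]
  refine lintegral_mono fun θ => ENNReal.ofReal_le_ofReal ?_
  refine mul_le_mul_of_nonneg_right (Real.rpow_le_rpow (norm_nonneg _) ?_ hp.le) (by positivity)
  rw [norm_div, Complex.norm_ofNat]
  linarith [norm_nonneg (F θ.toCircle + F 0)]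

/-- For small `t > 0` one has `|1 - exp (i t)| ≤ t ≤ 1`, so the integrand dominates `1 / t`. -/
theorem lintegral_norm_one_sub_toCircle_rpow_eq_top {δ s : ℝ} (hδ : 0 < δ) (hs : s ≤ -1) :
    ∫⁻ θ in {θ : UnitCircle | ‖1 - (θ.toCircle : ℂ)‖ < δ},
      ENNReal.ofReal (‖1 - (θ.toCircle : ℂ)‖ ^ s) = ∞ := by
  set η := min δ 1
  have hη : 0 < η := lt_min hδ one_pos
  have hη1 : η ≤ 1 := min_le_right _ _
  have hcT : Continuous fun θ : UnitCircle => ‖1 - (θ.toCircle : ℂ)‖ :=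
    (continuous_const.sub (continuous_comp_toCircle continuousOn_id)).norm
  have hms : MeasurableSet {θ : UnitCircle | ‖1 - (θ.toCircle : ℂ)‖ < δ} :=
    (isOpen_lt hcT continuous_const).measurableSet
  rw [← lintegral_indicator hms, ← AddCircle.lintegral_preimage (2 * π) 0, ← top_le_iff]
  have hinv : ∫⁻ t in Set.Ioo (0 : ℝ) η, ENNReal.ofReal t⁻¹ = ∞ := by
    by_contra hne
    have hint : IntegrableOn (fun t : ℝ => t⁻¹) (Set.Ioo 0 η) := by
      refine ⟨measurable_inv.aestronglyMeasurable, ?_⟩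
      rw [hasFiniteIntegral_iff_ofReal]
      · exact lt_top_iff_ne_top.2 hne
      · filter_upwards [ae_restrict_mem measurableSet_Ioo] with t ht
        exact inv_nonneg.2 ht.1.le
    have := (intervalIntegrable_iff_integrableOn_Ioo_of_le hη.le).2 hint
    rw [intervalIntegrable_inv_iff] at this
    rcases this with h | h
    · exact hη.ne h
    · exact h (by simp [hη.le])
  rw [← hinv]
  refine le_trans ?_ (lintegral_mono_set (s := Set.Ioo (0 : ℝ) η) fun t ht =>
    ⟨ht.1, by linarith [ht.2, Real.pi_gt_three]⟩)
  refine setLIntegral_mono' measurableSet_Ioo fun t ht => ?_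
  have ht0 : 0 < t := ht.1
  have hnorm : ‖1 - (AddCircle.toCircle (t : AddCircle (2 * π)) : ℂ)‖ ≤ t := by
    rw [coe_toCircle_coe, norm_sub_rev, mul_comm]
    have := Real.norm_exp_I_mul_ofReal_sub_one_le (x := t)
    rwa [Real.norm_of_nonneg ht0.le] at this
  have hpos : 0 < ‖1 - (AddCircle.toCircle (t : AddCircle (2 * π)) : ℂ)‖ := by
    rw [coe_toCircle_coe, norm_pos_iff, sub_ne_zero]
    intro h
    have h1 := congrArg Complex.im h
    rw [Complex.exp_ofReal_mul_I_im, Complex.one_im] at h1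
    exact (Real.sin_pos_of_pos_of_lt_pi ht0 (by linarith [ht.2, Real.pi_gt_three])).ne h1
  rw [Set.indicator_of_mem]
  · refine ENNReal.ofReal_le_ofReal ?_
    calc t⁻¹ ≤ ‖1 - (AddCircle.toCircle (t : AddCircle (2 * π)) : ℂ)‖⁻¹ := inv_anti₀ hpos hnorm
      _ = ‖1 - (AddCircle.toCircle (t : AddCircle (2 * π)) : ℂ)‖ ^ (-1 : ℝ) :=
        (Real.rpow_neg_one _).symm
      _ ≤ _ := Real.rpow_le_rpow_of_exponent_ge hpos
        (hnorm.trans (ht.2.le.trans hη1)) hs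
  · exact lt_of_le_of_lt hnorm (ht.2.trans_le (min_le_left _ _))

/-- Test on `conj z`: since `g 0 = 1`, on the circle `g conj z = (g - 1) / z + conj z`, so the
projection is `((g - 1) / z) / g`. Near `z = 1` the numerator has modulus close to `1` and `1 / g`
is not in `L^p(μ)`. -/
theorem not_boundedOnLp_powerWeight {a p : ℝ} (ha : 0 < a) (hp1 : 1 < p) (hap : 1 ≤ a * (p - 2)) :
    ¬ (powerWeight a ha).BoundedOnLp p := by
  rintro ⟨C, hC⟩
  have hp : 0 < p := by linarith
  set W := powerWeight a ha
  have hg0 : W.g 0 = 1 := by simp [W, powerWeight]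
  have hcT : Continuous fun θ : UnitCircle => (θ.toCircle : ℂ) :=
    continuous_comp_toCircle continuousOn_id
  have h0 : ball (0 : ℂ) 1 ∈ 𝓝 (0 : ℂ) := ball_mem_nhds _ one_pos
  -- `dslope` is `(g - 1) / z` with its removable singularity at `0` filled in.
  have hkd : DifferentiableOn ℂ (dslope W.g 0) (ball 0 1) :=
    (Complex.differentiableOn_dslope h0).2 W.differentiableOn
  have hkc : ContinuousOn (dslope W.g 0) (closedBall 0 1) :=
    (continuousOn_dslope (closedBall_mem_nhds _ one_pos)).2
      ⟨W.continuousOn, W.differentiableOn.differentiableAt h0⟩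
  have hslope : ∀ θ : UnitCircle, dslope W.g 0 θ.toCircle
      = conj (θ.toCircle : ℂ) * (W.g θ.toCircle - 1) := fun θ => by
    rw [dslope_of_ne _ (Circle.coe_ne_zero _), slope_def_field, hg0, sub_zero,
      ← Circle.coe_inv_eq_conj, Circle.coe_inv, div_eq_inv_mul]
  have hkm : MemLp (fun θ : UnitCircle => dslope W.g 0 θ.toCircle) 2 volume :=
    (continuous_comp_toCircle hkc).memLp_of_hasCompactSupport (HasCompactSupport.of_compactSpace _)
  have hconj : Continuous fun θ : UnitCircle => conj (θ.toCircle : ℂ) :=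
    Complex.continuous_conj.comp hcT
  have hfm : ∀ r : ℝ≥0∞, MemLp (fun θ : UnitCircle => conj (θ.toCircle : ℂ)) r W.measure :=
    fun r => MemLp.of_bound hconj.aestronglyMeasurable 1 (Eventually.of_forall fun θ => by
      rw [RCLike.norm_conj, Circle.norm_coe])
  set f := (hfm 2).toLp
  have hf : f =ᵐ[W.measure] fun θ => conj (θ.toCircle : ℂ) := MemLp.coeFn_toLp _
  set v := (W.memLp_div hkm).toLp
  have hv : v =ᵐ[W.measure] fun θ => dslope W.g 0 θ.toCircle / W.g θ.toCircle :=
    MemLp.coeFn_toLp _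
  have hS : W.szegoProjection f = v := by
    refine W.szegoProjection_eq_of_ae_eq (ae_powerWeight_g_ne_zero ha) hkd hkc
      (l := fun z => z) differentiableOn_id continuousOn_id rfl ?_ hv
    filter_upwards [hf, W.ae_ne_zero] with θ h1 h2
    rw [h1, hslope, eq_div_iff h2]
    ring
  have hfp : MemLp f (ENNReal.ofReal p) W.measure := (memLp_congr_ae hf).2 (hfm _)
  have hlt := (hC f hfp).trans_lt (ENNReal.mul_lt_top ENNReal.coe_lt_top hfp.2)
  rw [hS, eLpNorm_congr_ae hv, eLpNorm_div_powerWeight ha hp hkm.1] at hlt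
  refine hlt.ne ?_
  rw [ENNReal.rpow_eq_top_iff_of_pos (by positivity), ← top_le_iff]
  -- This makes `|g| ≤ 1/2`, hence `|g - 1| ≥ 1/2`, within distance `δ` of `1`.
  obtain ⟨δ, hδ, hδa⟩ : ∃ δ : ℝ, 0 < δ ∧ δ ^ a ≤ 1 / 2 :=
    ⟨(1 / 2) ^ a⁻¹, by positivity, by rw [← Real.rpow_mul (by norm_num), inv_mul_cancel₀ ha.ne',
      Real.rpow_one]⟩
  have hms : MeasurableSet {θ : UnitCircle | ‖1 - (θ.toCircle : ℂ)‖ < δ} :=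
    (isOpen_lt (continuous_const.sub hcT).norm continuous_const).measurableSet
  have htop := lintegral_norm_one_sub_toCircle_rpow_eq_top hδ
    (by linarith : a * (2 - p) ≤ -1)
  calc (∞ : ℝ≥0∞) = ENNReal.ofReal ((1 / 2) ^ p) *
        ∫⁻ θ in {θ : UnitCircle | ‖1 - (θ.toCircle : ℂ)‖ < δ},
          ENNReal.ofReal (‖1 - (θ.toCircle : ℂ)‖ ^ (a * (2 - p))) := by
        rw [htop, ENNReal.mul_top]
        simp only [ne_eq, ENNReal.ofReal_eq_zero, not_le]
        positivity
    _ = ∫⁻ θ in {θ : UnitCircle | ‖1 - (θ.toCircle : ℂ)‖ < δ},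
          ENNReal.ofReal ((1 / 2) ^ p * ‖1 - (θ.toCircle : ℂ)‖ ^ (a * (2 - p))) := by
        rw [← lintegral_const_mul' _ _ ENNReal.ofReal_ne_top]
        refine lintegral_congr fun θ => ?_
        rw [ENNReal.ofReal_mul (by positivity)]
    _ ≤ ∫⁻ θ in {θ : UnitCircle | ‖1 - (θ.toCircle : ℂ)‖ < δ}, ENNReal.ofReal
          (‖dslope W.g 0 θ.toCircle‖ ^ p * ‖1 - (θ.toCircle : ℂ)‖ ^ (a * (2 - p))) := by
        refine setLIntegral_mono' hms fun θ hθ => ENNReal.ofReal_le_ofReal ?_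
        refine mul_le_mul_of_nonneg_right (Real.rpow_le_rpow (by norm_num) ?_ hp.le) (by positivity)
        have h1 : ‖W.g θ.toCircle‖ ≤ 1 / 2 := by
          rw [norm_powerWeight_g]
          exact (Real.rpow_le_rpow (norm_nonneg _) (le_of_lt hθ) ha.le).trans hδa
        rw [hslope, norm_mul, RCLike.norm_conj, Circle.norm_coe, one_mul, norm_sub_rev]
        have h2 := norm_sub_norm_le (1 : ℂ) (W.g θ.toCircle)
        rw [norm_one] at h2
        linarith
    _ ≤ _ := setLIntegral_le_lintegral _ _

end HolomorphicWeight

/-! ### The boundedness interval. -/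

theorem theorem1p1 (p₀ q₀ : ℝ) (hp₀ : 2 < p₀) (hq₀ : 1 / q₀ + 1 / p₀ = 1) :
    ∃ W : HolomorphicWeight, W.boundednessInterval = Set.Ioo q₀ p₀ := by
  have ha : 0 < 1 / (p₀ - 2) := one_div_pos.2 (by linarith)
  have hq : q₀ * (p₀ - 1) = p₀ := by
    -- With the convention `1 / 0 = 0`, the value `q₀ = 0` would force `p₀ = 1`.
    have hq0 : q₀ ≠ 0 := by
      rintro rfl
      rw [div_zero, zero_add, div_eq_one_iff_eq (by linarith)] at hq₀
      linarith
    field_simp at hq₀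
    linarith
  have hbdd : ∀ p : ℝ, q₀ < p → p < 2 → (powerWeight _ ha).BoundedOnLp p := by
    intro p h1 h2
    have h3 : p₀ < p * (p₀ - 1) := by
      have := mul_lt_mul_of_pos_right h1 (by linarith : 0 < p₀ - 1)
      rwa [hq] at this
    refine HolomorphicWeight.boundedOnLp_powerWeight_of_le_two ha (by nlinarith) h2 ?_
    rw [one_div_mul_eq_div, div_lt_iff₀ (by linarith : (0 : ℝ) < p₀ - 2)]
    linarith
  have hunb : ∀ p : ℝ, p₀ ≤ p → ¬ (powerWeight _ ha).BoundedOnLp p := by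
    intro p h1
    refine HolomorphicWeight.not_boundedOnLp_powerWeight ha (by linarith) ?_
    rw [one_div_mul_eq_div, le_div_iff₀ (by linarith : (0 : ℝ) < p₀ - 2)]
    linarith
  refine ⟨powerWeight _ ha, Set.ext fun p => ⟨fun ⟨hp1, hb⟩ => ⟨?_, ?_⟩, fun ⟨h1, h2⟩ => ?_⟩⟩
  -- If `p ≤ q₀`, the conjugate exponent is at least `p₀`, where boundedness already fails.
  · by_contra! h
    have hpq := Real.HolderConjugate.conjExponent hp1
    refine hunb p.conjExponent ?_ (hb.holderConjugate hpq)
    rw [Real.conjExponent, le_div_iff₀ (by linarith)]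
    nlinarith
  · by_contra! h
    exact hunb p h hb
  · have hp1 : 1 < p := by nlinarith
    refine ⟨hp1, ?_⟩
    rcases lt_trichotomy p 2 with h | rfl | h
    · exact hbdd p h1 h
    · exact HolomorphicWeight.boundedOnLp_two _
    · have hpq := Real.HolderConjugate.conjExponent hp1
      refine (hbdd p.conjExponent ?_ ?_).holderConjugate hpq.symm
      · rw [Real.conjExponent, lt_div_iff₀ (by linarith)]
        nlinarith
      · rw [Real.conjExponent, div_lt_iff₀ (by linarith)]
        linarith
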